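/- Let $\Bbbk$ be a field of characteristic $2$, let $G=\langle\sigma,\tau\rangle$ be the Klein four-group, and let $\chi=\{\langle\sigma\rangle,\langle\tau\rangle,\langle\sigma\tau\rangle\}$ be the set of its proper nontrivial subgroups. All $\Bbbk G$-modules are finite-dimensional over $\Bbbk$. A surjective $\Bbbk G$-homomorphism is called $\chi$-split if it splits on restriction to every $H\in\chi$, and a $\Bbbk G$-module $M$ is projective relative to $\chi$ if every $\Bbbk G$-homomorphism $M\to Y$ lifts along every $\chi$-split surjection $X\to Y$. A relatively projective resolution of the trivial module $\Bbbk$ is an exact complex $\cdots\to Q_1\to Q_0\to\Bbbk\to 0$ in which each $Q_i$ is projective relative to $\chi$ and each map, viewed as a surjection onto its image, is $\chi$-split. For a $\Bbbk G$-module $N$, the relative cohomology $H^i_\chi(G,N)$ $(i\ge 0)$ is the $i$-th cohomology of the complex $0\to\operatorname{Hom}_{\Bbbk G}(Q_0,N)\to\operatorname{Hom}_{\Bbbk G}(Q_1,N)\to\cdots$ (such resolutions exist, and up to isomorphism the result does not depend on the choice of one). For $n\ge 1$ let $V_{-(2n+1)}$ be the $(2n+1)$-dimensional $\Bbbk G$-module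 with basis $a_1,\dots,a_n,b_0,\dots,b_n$ on which $X=\sigma-1$ and $Y=\tau-1$ act by $Xa_j=b_{j-1}$, $Ya_j=b_j$ for $1\le j\le n$ and $Xb_j=Yb_j=0$ for $0\le j\le n$. Proposition. Let $N\cong V_{-(2n+1)}$ where $n\ge 1$. Then a relatively projective resolution of $\Bbbk$ exists, and for every $i\ge 0$ (computing with any such resolution) $$\dim_{\Bbbk} H^i_\chi(G,N)=\begin{cases} n+1-2i & \text{if } i\le n/2,\\ \max(0,\,2i-n-3) & \text{if } i>n/2.\end{cases}$$ -/

import Mathlib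

open CategoryTheory

universe u v

noncomputable section

/-! ### Relative projectivity and relative Ext -/

section Relative

variable {k : Type u} {G : Type v} [Field k] [Group G]

/-- A `kG`-homomorphism `f : A ⟶ B`, viewed as a surjection `A → im f`, splits on restriction to
every subgroup `H` in `χ`: for each `H ∈ χ` there is a `kH`-linear map `s : im f → A` with
`f ∘ s = id`. When `f` is surjective this says that `f` is a `χ`-split epimorphism. -/
def IsRelSplit (χ : Set (Subgroup G)) {A B : Rep.{u} k G} (f : A ⟶ B) : Prop :=
  ∀ H ∈ χ, ∃ s : LinearMap.range f.hom.toLinearMap →ₗ[k] A,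
    (∀ y, f.hom (s y) = y) ∧
    ∀ h ∈ H, ∀ y z : LinearMap.range f.hom.toLinearMap,
      (z : B) = B.ρ h y → s z = A.ρ h (s y)

/-- `M` is projective relative to `χ`: every homomorphism `φ : M ⟶ Y` lifts along every surjection
`j : X ⟶ Y` of finite-dimensional `kG`-modules that splits on restriction to each `H ∈ χ`. -/
def IsRelProjective (χ : Set (Subgroup G)) (M : Rep.{u} k G) : Prop :=
  ∀ (X Y : Rep.{u} k G) [Module.Finite k X] [Module.Finite k Y] (j : X ⟶ Y) (φ : M ⟶ Y),
    Function.Surjective j.hom → IsRelSplit χ j → ∃ ψ : M ⟶ X, ψ ≫ j = φ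

/-- A resolution `⋯ ⟶ Q₁ ⟶ Q₀ ⟶ M ⟶ 0` of `M` which is projective relative to `χ`: an exact complex
in which every `Qᵢ` is finite-dimensional and projective relative to `χ`, and all of whose maps
split (as maps onto their images) on restriction to each `H ∈ χ`. -/
structure RelProjectiveResolution (χ : Set (Subgroup G)) (M : Rep.{u} k G) where
  /-- The complex `⋯ ⟶ Q₁ ⟶ Q₀`. -/
  complex : ChainComplex (Rep.{u} k G) ℕ
  /-- The augmentation `Q₀ ⟶ M`. -/
  ε : complex.X 0 ⟶ M
  finite : ∀ i, Module.Finite k (complex.X i)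
  relProjective : ∀ i, IsRelProjective χ (complex.X i)
  surjective_ε : Function.Surjective ε.hom
  exact_zero : Function.Exact (complex.d 1 0).hom ε.hom
  exact_succ : ∀ i, Function.Exact (complex.d (i + 2) (i + 1)).hom (complex.d (i + 1) i).hom
  split_ε : IsRelSplit χ ε
  split_d : ∀ i, IsRelSplit χ (complex.d (i + 1) i)

/-- The relative Ext-group `Ext^i_{kG,χ}(M, N)`, computed from the relatively projective resolution
`R` of `M`: the `i`-th cohomology of `0 ⟶ Hom_{kG}(Q₀, N) ⟶ Hom_{kG}(Q₁, N) ⟶ ⋯`. -/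
def RelProjectiveResolution.ext {χ : Set (Subgroup G)} {M : Rep.{u} k G}
    (R : RelProjectiveResolution χ M) (i : ℕ) (N : Rep.{u} k G) : ModuleCat.{u} k :=
  (R.complex.linearYonedaObj k N).homology i

end Relative

/-! ### The modules `V_{-(2n+1)}` of the Klein four-group -/

namespace KleinFour

variable (k : Type u) {G : Type v} [Field k] [Group G]

/-- The set `{⟨σ⟩, ⟨τ⟩, ⟨στ⟩}`. -/
def chi (σ τ : G) : Set (Subgroup G) :=
  {Subgroup.zpowers σ, Subgroup.zpowers τ, Subgroup.zpowers (σ * τ)}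

/-- The underlying vector space of `V_{-(2n+1)}`, with basis `a₁, …, aₙ, b₀, …, bₙ`. -/
abbrev NegSpace (n : ℕ) : Type u := (Fin n ⊕ Fin (n + 1)) →₀ k

variable {n : ℕ}

/-- The basis vector `a_{j+1}`. -/
def a (j : Fin n) : NegSpace k n := Finsupp.single (Sum.inl j) 1

/-- The basis vector `b_j`. -/
def b (j : Fin (n + 1)) : NegSpace k n := Finsupp.single (Sum.inr j) 1

variable (n)

/-- The operator `X`: it sends `a_{j+1}` to `b_j` and all `b`'s to `0`. -/
def negX : NegSpace k n →ₗ[k] NegSpace k n :=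
  Finsupp.linearCombination k (Sum.elim (fun j : Fin n => b k j.castSucc) 0)

/-- The operator `Y`: it sends `a_{j+1}` to `b_{j+1}` and all `b`'s to `0`. -/
def negY : NegSpace k n →ₗ[k] NegSpace k n :=
  Finsupp.linearCombination k (Sum.elim (fun j : Fin n => b k j.succ) 0)

theorem negX_a (j : Fin n) : negX k n (a k j) = b k j.castSucc := by simp [negX, a]
theorem negX_b (j : Fin (n + 1)) : negX k n (b k j) = 0 := by simp [negX, b]
theorem negY_a (j : Fin n) : negY k n (a k j) = b k j.succ := by simp [negY, a]
theorem negY_b (j : Fin (n + 1)) : negY k n (b k j) = 0 := by simp [negY, b]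

theorem negX_mul_negX : negX k n * negX k n = 0 := by
  ext (j | j) : 2
  · exact (congrArg _ (negX_a k n j)).trans (negX_b k n _)
  · exact (congrArg _ (negX_b k n j)).trans (map_zero (negX k n))

theorem negX_mul_negY : negX k n * negY k n = 0 := by
  ext (j | j) : 2
  · exact (congrArg _ (negY_a k n j)).trans (negX_b k n _)
  · exact (congrArg _ (negY_b k n j)).trans (map_zero (negX k n))

theorem negY_mul_negX : negY k n * negX k n = 0 := by
  ext (j | j) : 2
  · exact (congrArg _ (negX_a k n j)).trans (negY_b k n _)
  · exact (congrArg _ (negX_b k n j)).trans (map_zero (negY k n))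

theorem negY_mul_negY : negY k n * negY k n = 0 := by
  ext (j | j) : 2
  · exact (congrArg _ (negY_a k n j)).trans (negY_b k n _)
  · exact (congrArg _ (negY_b k n j)).trans (map_zero (negY k n))

open Classical in
/-- For distinct elements `p, q ≠ 1` of a Klein four-group, the homomorphism to `(k, +)` with
kernel `⟨q⟩` that sends `p` and `p * q` to `1` (when `k` has characteristic two). -/
def coeff (q g : G) : k := if g = 1 ∨ g = q then 0 else 1

theorem coeff_mul [CharP k 2] [IsKleinFour G] {p q : G} (hp : p ≠ 1) (hq : q ≠ 1) (hpq : p ≠ q)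
    (g h : G) : coeff k q (g * h) = coeff k q g + coeff k q h := by
  have h2 : (1 : k) + 1 = 0 := CharTwo.add_self_eq_zero 1
  have hpp := IsKleinFour.mul_self p
  have hqq := IsKleinFour.mul_self q
  have hc : ∀ x y : G, x * y = y * x := (IsKleinFour.isMulCommutative (G := G)).is_comm.comm
  have hall : ∀ z : G, z = 1 ∨ z = q ∨ z = p ∨ z = p * q := by
    intro z
    by_contra hz
    push Not at hz
    exact hz.2.2.2 (IsKleinFour.eq_mul_of_ne_all hp hq hpq hz.1 hz.2.2.1 hz.2.1)
  have hpq1 : p * q ≠ 1 := fun e => hpq (by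
    rw [← mul_one p, ← hqq, ← mul_assoc, e, one_mul])
  have hpqq : p * q ≠ q := fun e => hp (by simpa using e)
  have e1 : p * q * p = q := by rw [hc p q, mul_assoc, hpp, mul_one]
  have e2 : p * q * q = p := by rw [mul_assoc, hqq, mul_one]
  have e3 : p * (p * q) = q := by rw [← mul_assoc, hpp, one_mul]
  have e4 : q * (p * q) = p := by rw [hc q, e2]
  have e5 : p * q * (p * q) = 1 := IsKleinFour.mul_self _
  rcases hall g with rfl | rfl | rfl | rfl <;> rcases hall h with rfl | rfl | rfl | rfl <;>
    simp_all [coeff]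

/-- The `kG`-module `V_{-(2n+1)}`, where `G` is the Klein four-group generated by `σ` and `τ`:
the element `σ` acts as `1 + X` and `τ` acts as `1 + Y` (and so `σ * τ` acts as `1 + X + Y`). -/
def negRep [CharP k 2] [IsKleinFour G] {σ τ : G} (hσ : σ ≠ 1) (hτ : τ ≠ 1) (hστ : σ ≠ τ) :
    Representation k G (NegSpace k n) where
  toFun g := 1 + coeff k τ g • negX k n + coeff k σ g • negY k n
  map_one' := by simp [coeff]
  map_mul' g h := by
    rw [coeff_mul k hσ hτ hστ, coeff_mul k hτ hσ hστ.symm]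
    simp only [mul_add, add_mul, one_mul, mul_one, smul_mul_smul_comm, negX_mul_negX,
      negX_mul_negY, negY_mul_negX, negY_mul_negY, smul_zero, add_zero, add_smul]
    abel

theorem negRep_left [CharP k 2] [IsKleinFour G] {σ τ : G} (hσ : σ ≠ 1) (hτ : τ ≠ 1)
    (hστ : σ ≠ τ) : negRep k n hσ hτ hστ σ = 1 + negX k n := by
  simp [negRep, coeff, hσ, hστ]

theorem negRep_right [CharP k 2] [IsKleinFour G] {σ τ : G} (hσ : σ ≠ 1) (hτ : τ ≠ 1)
    (hστ : σ ≠ τ) : negRep k n hσ hτ hστ τ = 1 + negY k n := by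
  simp [negRep, coeff, hτ, hστ.symm]

/-- `V_{-(2n+1)}` as an object of the category of `kG`-modules. -/
abbrev VNeg [CharP k 2] [IsKleinFour G] {σ τ : G} (hσ : σ ≠ 1) (hτ : τ ≠ 1) (hστ : σ ≠ τ) :
    Rep.{u} k G :=
  Rep.of (negRep k n hσ hτ hστ)

end KleinFour

end

/-! Write `V_{-(2m+1)}` as pairs (f, g) of polynomials in t with deg f < m and deg g ≤ m. Here X
sends f to f in the second slot, Y sends f to tf, and so X + Y sends f to (1 + t)f. For each H in χ,
restriction to H gives a free module plus one trivial summand, which is spanned by a complement of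
the image of 1, t or 1 + t on polynomials of degree < m.

The module k[G/⟨σ⟩] ⊕ k[G/⟨τ⟩] ⊕ k[G/⟨στ⟩] ⊕ kG^m therefore maps χ-splittingly onto `V_{-(2m+1)}`:
the permutation summands hit the three complements and the free part hits the rest (`cover_split`).
The source is projective relative to χ, since maps out of k[G/H] are H-fixed vectors and these lift
along χ-split surjections (`isRelProjective_relFree`). The kernel is `V_{-(2m+5)}`
(`exact_syzygyInclusion_cover`). Starting from m = 0, where the module is trivial, splicing gives a
resolution with syzygies `V_{-(4i+1)}`.

By left exactness and rank-nullity, dim H^{j+1} = dim Hom(K_{j+1}, N) + dim Hom(K_j, N) - dim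
Hom(Q_j, N), and H^0 = Hom(K_0, N). A map from `V_{-(2m+1)}` to `V_{-(2n+1)}` is multiplication by a
polynomial of degree ≤ n - m plus an arbitrary linear map from top to socle (`finrank_polyRep_hom`),
and Hom(Q_j, N) is read off from generators (`finrank_relFree_hom`). The comparison theorem for
relative resolutions transfers the result to any other resolution. -/

noncomputable section

/-! ### Comparison theorem for relatively projective resolutions -/

section Comparison

variable {k : Type u} {G : Type v} [Field k] [Group G] {χ : Set (Subgroup G)}

/-- Homomorphisms out of a relatively projective module lift along relatively split maps onto
any submodule containing their image. -/
theorem IsRelProjective.exists_lift {P A B C : Rep.{u} k G} (hP : IsRelProjective χ P)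
    [Module.Finite k A] {g : A ⟶ B} {h : B ⟶ C} (hex : Function.Exact g.hom h.hom)
    (hs : IsRelSplit χ g) (f : P ⟶ B) (w : f ≫ h = 0) : ∃ l : P ⟶ A, l ≫ g = f := by
  have hW : ∀ x, LinearMap.range g.hom.toLinearMap ≤
      (LinearMap.range g.hom.toLinearMap).comap (B.ρ x) := by
    rintro x _ ⟨y, rfl⟩
    exact ⟨A.ρ x y, Rep.hom_comm_apply g x y⟩
  have hf : ∀ p, f.hom.toLinearMap p ∈ LinearMap.range g.hom.toLinearMap := fun p =>
    (hex _).1 (congrArg (fun q : P ⟶ C => q.hom p) w)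
  -- Relative projectivity lifts only along surjections, so `B` is replaced by the image of `g`;
  -- exactness puts the image of `f` inside it.
  let Y := B.subrepresentation _ hW
  let j : A ⟶ Y := Rep.ofHom ⟨g.hom.toLinearMap.rangeRestrict, fun x => by
    ext a; exact Rep.hom_comm_apply g x a⟩
  let φ : P ⟶ Y := Rep.ofHom ⟨f.hom.toLinearMap.codRestrict _ hf, fun x => by
    ext a; exact Rep.hom_comm_apply f x a⟩
  have hj : Function.Surjective j.hom := LinearMap.surjective_rangeRestrict g.hom.toLinearMap
  have : Module.Finite k Y :=
    Module.Finite.range g.hom.toLinearMap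
  obtain ⟨ψ, hψ⟩ := hP A Y j φ hj (fun H hH => by
    obtain ⟨s, hs1, hs2⟩ := hs H hH
    refine ⟨s ∘ₗ Submodule.subtype _, fun y => Subtype.ext (hs1 y.1), fun x hx y z hyz =>
      hs2 x hx y.1 z.1 (congrArg Subtype.val hyz)⟩)
  refine ⟨ψ, ?_⟩
  ext p
  exact congrArg (fun q : P ⟶ Y => (q.hom p).1) hψ

namespace RelProjectiveResolution

variable {M : Rep.{u} k G}

attribute [local instance] RelProjectiveResolution.finite

theorem d_comp_ε (R : RelProjectiveResolution χ M) : R.complex.d 1 0 ≫ R.ε = 0 := by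
  ext x
  exact (R.exact_zero _).2 ⟨x, rfl⟩

theorem exists_lift_ε (R S : RelProjectiveResolution χ M) :
    ∃ f : R.complex.X 0 ⟶ S.complex.X 0, f ≫ S.ε = R.ε :=
  (R.relProjective 0).exists_lift (h := (0 : M ⟶ M))
    (fun y => ⟨fun _ => S.surjective_ε y, fun _ => rfl⟩) S.split_ε R.ε (by simp)

theorem exists_lift_zero (R S : RelProjectiveResolution χ M) {i : ℕ}
    (f : R.complex.X i ⟶ S.complex.X 0) (w : f ≫ S.ε = 0) :
    ∃ l : R.complex.X i ⟶ S.complex.X 1, l ≫ S.complex.d 1 0 = f :=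
  (R.relProjective i).exists_lift S.exact_zero (S.split_d 0) f w

theorem exists_lift_succ (R S : RelProjectiveResolution χ M) {i j : ℕ}
    (f : R.complex.X i ⟶ S.complex.X (j + 1)) (w : f ≫ S.complex.d (j + 1) j = 0) :
    ∃ l : R.complex.X i ⟶ S.complex.X (j + 2), l ≫ S.complex.d (j + 2) (j + 1) = f :=
  (R.relProjective i).exists_lift (S.exact_succ j) (S.split_d (j + 1)) f w

/-- The identity of `M` lifts to a chain map between relatively projective resolutions. -/
theorem exists_chainMap (R S : RelProjectiveResolution χ M) :
    ∃ f : R.complex ⟶ S.complex, f.f 0 ≫ S.ε = R.ε := by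
  choose f₀ h₀ using R.exists_lift_ε S
  choose f₁ h₁ using R.exists_lift_zero S (R.complex.d 1 0 ≫ f₀) (by simp [h₀, R.d_comp_ε])
  have hsucc : ∀ (n : ℕ) (p : Σ' (f : R.complex.X n ⟶ S.complex.X n)
      (f' : R.complex.X (n + 1) ⟶ S.complex.X (n + 1)),
        f' ≫ S.complex.d (n + 1) n = R.complex.d (n + 1) n ≫ f),
      ∃ f'' : R.complex.X (n + 2) ⟶ S.complex.X (n + 2),
        f'' ≫ S.complex.d (n + 2) (n + 1) = R.complex.d (n + 2) (n + 1) ≫ p.2.1 := fun n p =>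
    R.exists_lift_succ S _ (by simp [p.2.2])
  choose g hg using hsucc
  exact ⟨ChainComplex.mkHom _ _ f₀ f₁ h₁ fun n p => ⟨g n p, hg n p⟩, h₀⟩

/-- A chain map which is zero on the resolved module is null-homotopic. -/
theorem nonempty_homotopy_zero (R S : RelProjectiveResolution χ M) (f : R.complex ⟶ S.complex)
    (w : f.f 0 ≫ S.ε = 0) : Nonempty (Homotopy f 0) := by
  choose s₀ h₀ using R.exists_lift_zero S (f.f 0) w
  choose s₁ h₁ using R.exists_lift_succ S (f.f 1 - R.complex.d 1 0 ≫ s₀) (by simp [h₀])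
  have hsucc : ∀ (n : ℕ) (p : Σ' (g : R.complex.X n ⟶ S.complex.X (n + 1))
      (g' : R.complex.X (n + 1) ⟶ S.complex.X (n + 2)),
        f.f (n + 1) = R.complex.d (n + 1) n ≫ g + g' ≫ S.complex.d (n + 2) (n + 1)),
      ∃ g'' : R.complex.X (n + 2) ⟶ S.complex.X (n + 3),
        g'' ≫ S.complex.d (n + 3) (n + 2) =
          f.f (n + 2) - R.complex.d (n + 2) (n + 1) ≫ p.2.1 := fun n p =>
    R.exists_lift_succ S _ (by
      have := p.2.2
      simp [this])
  choose g hg using hsucc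
  exact ⟨Homotopy.mkInductive _ s₀ h₀.symm s₁ (by simp [h₁]) fun n p =>
    ⟨g n p, by simp [hg]⟩⟩

theorem nonempty_homotopyEquiv (R S : RelProjectiveResolution χ M) :
    Nonempty (HomotopyEquiv R.complex S.complex) := by
  obtain ⟨f, hf⟩ := R.exists_chainMap S
  obtain ⟨g, hg⟩ := S.exists_chainMap R
  obtain ⟨s⟩ := R.nonempty_homotopy_zero R (f ≫ g - 𝟙 _) (by simp [hf, hg])
  obtain ⟨t⟩ := S.nonempty_homotopy_zero S (g ≫ f - 𝟙 _) (by simp [hf, hg])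
  exact ⟨⟨f, g, Homotopy.equivSubZero.symm s, Homotopy.equivSubZero.symm t⟩⟩

/-- The relative Ext-groups do not depend on the choice of the resolution. -/
theorem nonempty_ext_linearEquiv (R S : RelProjectiveResolution χ M) (i : ℕ) (N : Rep.{u} k G) :
    Nonempty (R.ext i N ≃ₗ[k] S.ext i N) := by
  obtain ⟨e⟩ := R.nonempty_homotopyEquiv S
  let e' := ((((linearYoneda k _).obj N).rightOp.mapHomotopyEquiv e).toHomologyIso i).unop
  exact ⟨((HomologicalComplex.homologyUnop _ i ≪≫ e'.symm ≪≫
    (HomologicalComplex.homologyUnop _ i).symm).toLinearEquiv)⟩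

end RelProjectiveResolution

end Comparison

/-! ### Splicing short exact sequences and counting dimensions of cohomology -/

section Splicing

variable {k : Type u} {G : Type v} [Field k] [Group G] {χ : Set (Subgroup G)}

/-- Relatively split short exact sequences `0 ⟶ Kᵢ₊₁ ⟶ Qᵢ ⟶ Kᵢ ⟶ 0` with `K₀ ≅ M`, each `Qᵢ` being
relatively projective. -/
structure RelSyzygies (χ : Set (Subgroup G)) (M : Rep.{u} k G) where
  /-- The syzygies. -/
  K : ℕ → Rep.{u} k G
  /-- The relatively projective modules. -/
  Q : ℕ → Rep.{u} k G
  /-- The inclusions of the syzygies. -/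
  ι : ∀ i, K (i + 1) ⟶ Q i
  /-- The relatively split surjections. -/
  π : ∀ i, Q i ⟶ K i
  /-- The identification of the zeroth syzygy. -/
  e : K 0 ≅ M
  finite : ∀ i, Module.Finite k (Q i)
  relProjective : ∀ i, IsRelProjective χ (Q i)
  injective_ι : ∀ i, Function.Injective (ι i).hom
  surjective_π : ∀ i, Function.Surjective (π i).hom
  exact : ∀ i, Function.Exact (ι i).hom (π i).hom
  split : ∀ i, ∀ H ∈ χ, ∃ s : K i →ₗ[k] Q i, (∀ y, (π i).hom (s y) = y) ∧
    ∀ h ∈ H, ∀ y, s ((K i).ρ h y) = (Q i).ρ h (s y)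

/-- Since `j` identifies `B` with its image, a section of `p` becomes a section over the image of
the composite. -/
theorem IsRelSplit.of_section {A B C : Rep.{u} k G} (p : A ⟶ B) (j : B ⟶ C)
    (hj : Function.Injective j.hom)
    (hs : ∀ H ∈ χ, ∃ s : B →ₗ[k] A, (∀ y, p.hom (s y) = y) ∧
      ∀ h ∈ H, ∀ y, s (B.ρ h y) = A.ρ h (s y)) : IsRelSplit χ (p ≫ j) := by
  intro H hH
  obtain ⟨s, hs1, hs2⟩ := hs H hH
  have hle : LinearMap.range (p ≫ j).hom.toLinearMap ≤ LinearMap.range j.hom.toLinearMap := by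
    rintro _ ⟨x, rfl⟩
    exact ⟨p.hom x, rfl⟩
  let e := LinearEquiv.ofInjective j.hom.toLinearMap hj
  have he : ∀ y, j.hom (e.symm y) = y := fun y => congrArg Subtype.val (e.apply_symm_apply y)
  refine ⟨s ∘ₗ e.symm.toLinearMap ∘ₗ Submodule.inclusion hle, fun y => ?_, fun h hh y z hz => ?_⟩
  · change j.hom (p.hom (s (e.symm (Submodule.inclusion hle y)))) = y
    rw [hs1, he, Submodule.coe_inclusion]
  · change s (e.symm (Submodule.inclusion hle z)) =
      A.ρ h (s (e.symm (Submodule.inclusion hle y)))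
    rw [← hs2 h hh]
    congr 1
    apply hj
    rw [he, Rep.hom_comm_apply, he]
    exact hz

namespace RelSyzygies

variable {M : Rep.{u} k G} (S : RelSyzygies χ M)

theorem ι_comp_π (i : ℕ) : S.ι i ≫ S.π i = 0 := by
  ext x
  exact (S.exact i _).2 ⟨x, rfl⟩

/-- The spliced complex. -/
def complex : ChainComplex (Rep.{u} k G) ℕ :=
  ChainComplex.of S.Q (fun i => S.π (i + 1) ≫ S.ι i) fun i => by
    rw [Category.assoc, ← Category.assoc (S.ι (i + 1)), ι_comp_π, Limits.zero_comp,
      Limits.comp_zero]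

theorem complex_d (i : ℕ) : S.complex.d (i + 1) i = S.π (i + 1) ≫ S.ι i :=
  ChainComplex.of_d S.Q (fun i => S.π (i + 1) ≫ S.ι i) i

theorem exact_comp {X A B C D : Rep.{u} k G} {f : X ⟶ A} {i : A ⟶ B} {p : B ⟶ C} {j : C ⟶ D}
    (hf : Function.Surjective f.hom) (hj : Function.Injective j.hom)
    (h : Function.Exact i.hom p.hom) : Function.Exact (f ≫ i).hom (p ≫ j).hom := by
  intro y
  constructor
  · intro hy
    have hy' : j.hom (p.hom y) = 0 := hy
    obtain ⟨a, rfl⟩ := (h y).1 (hj (hy'.trans (map_zero j.hom).symm))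
    obtain ⟨x, rfl⟩ := hf a
    exact ⟨x, rfl⟩
  · rintro ⟨x, rfl⟩
    exact (congrArg j.hom ((h _).2 ⟨f.hom x, rfl⟩)).trans (map_zero j.hom)

theorem injective_e : Function.Injective S.e.hom.hom := fun x y h => by
  rw [← Rep.inv_hom_apply _ _ S.e x, h, Rep.inv_hom_apply]

/-- The resolution obtained by splicing. -/
def resolution : RelProjectiveResolution χ M where
  complex := S.complex
  ε := S.π 0 ≫ S.e.hom
  finite := S.finite
  relProjective := S.relProjective
  surjective_ε y := by
    obtain ⟨x, hx⟩ := S.surjective_π 0 (S.e.inv.hom y)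
    exact ⟨x, (congrArg S.e.hom.hom hx).trans (Rep.hom_inv_apply _ _ S.e y)⟩
  exact_zero := by
    rw [complex_d]
    exact exact_comp (S.surjective_π 1) S.injective_e (S.exact 0)
  exact_succ i := by
    rw [complex_d, complex_d]
    exact exact_comp (S.surjective_π _) (S.injective_ι i) (S.exact _)
  split_ε := IsRelSplit.of_section _ _ S.injective_e (S.split 0)
  split_d i := by
    rw [complex_d]
    exact IsRelSplit.of_section _ _ (S.injective_ι i) (S.split _)

end RelSyzygies

instance Rep.finite_hom {A B : Rep.{u} k G} [Module.Finite k A] [Module.Finite k B] :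
    Module.Finite k (A ⟶ B) :=
  Module.Finite.of_injective
    ({ toFun := fun f => f.hom.toLinearMap
       map_add' := fun _ _ => rfl
       map_smul' := fun _ _ => rfl } : (A ⟶ B) →ₗ[k] A →ₗ[k] B)
    fun _ _ h => Rep.hom_ext (Representation.IntertwiningMap.ext h)

/-- Homomorphisms out of a quotient. -/
theorem Rep.exists_desc {A B C N : Rep.{u} k G} {i : A ⟶ B} {p : B ⟶ C}
    (hp : Function.Surjective p.hom) (h : Function.Exact i.hom p.hom) (f : B ⟶ N)
    (w : i ≫ f = 0) : ∃ g : C ⟶ N, p ≫ g = f := by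
  obtain ⟨s, hs⟩ := p.hom.toLinearMap.exists_rightInverse_of_surjective
    (LinearMap.range_eq_top.2 hp)
  have hs' : ∀ y, p.hom (s y) = y := fun y => LinearMap.congr_fun hs y
  have key : ∀ x, f.hom (s (p.hom x)) = f.hom x := by
    intro x
    obtain ⟨a, ha⟩ := (h (s (p.hom x) - x)).1 (by rw [map_sub, hs', sub_self])
    have : f.hom (i.hom a) = 0 := congrArg (fun q : A ⟶ N => q.hom a) w
    rw [ha, map_sub] at this
    exact sub_eq_zero.1 this
  refine ⟨Rep.ofHom ⟨f.hom.toLinearMap ∘ₗ s, fun x => ?_⟩, ?_⟩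
  · ext y
    obtain ⟨b, rfl⟩ := hp y
    change f.hom (s (C.ρ x (p.hom b))) = N.ρ x (f.hom (s (p.hom b)))
    rw [← Rep.hom_comm_apply, key, key, Rep.hom_comm_apply]
  · ext x
    exact key x

theorem ModuleCat.finrank_homology_add (S : ShortComplex (ModuleCat.{u} k))
    [Module.Finite k S.X₂] : Module.Finite k S.homology ∧
      Module.finrank k S.homology + Module.finrank k (LinearMap.range S.f.hom) =
        Module.finrank k (LinearMap.ker S.g.hom) := by
  let e := S.moduleCatHomologyIso.toLinearEquiv
  have hr : Module.finrank k (LinearMap.range S.moduleCatToCycles) =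
      Module.finrank k (LinearMap.range S.f.hom) := by
    have : (LinearMap.range S.moduleCatToCycles).map (LinearMap.ker S.g.hom).subtype =
        LinearMap.range S.f.hom := by
      rw [← LinearMap.range_comp]
      rfl
    rw [← this]
    exact (Submodule.finrank_map_subtype_eq _ _).symm
  have hfin : Module.Finite k S.moduleCatLeftHomologyData.H :=
    inferInstanceAs (Module.Finite k
      (LinearMap.ker S.g.hom ⧸ LinearMap.range S.moduleCatToCycles))
  refine ⟨Module.Finite.equiv e.symm, ?_⟩
  rw [e.finrank_eq, ← hr]
  exact Submodule.finrank_quotient_add_finrank _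

namespace RelSyzygies

variable {M : Rep.{u} k G} (S : RelSyzygies χ M) (N : Rep.{u} k G)

theorem comp_d_eq_zero_iff (i : ℕ) (f : S.Q i ⟶ N) :
    S.complex.d (i + 1) i ≫ f = 0 ↔ S.ι i ≫ f = 0 := by
  rw [complex_d]
  change S.π (i + 1) ≫ S.ι i ≫ f = 0 ↔ _
  refine ⟨fun h => ?_, fun h => by rw [h, Limits.comp_zero]⟩
  have : Epi (S.π (i + 1)) := (Rep.epi_iff_surjective _).2 (S.surjective_π _)
  exact (cancel_epi (S.π (i + 1))).1 (h.trans Limits.comp_zero.symm)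

/-- Left exactness of Hom(-, N): a map on `Q i` is a cocycle exactly when it kills the image of `K
(i + 1)`, that is, when it factors through `K i`. -/
theorem finrank_ker (i : ℕ) :
    Module.finrank k (LinearMap.ker ((S.complex.linearYonedaObj k N).d i (i + 1)).hom) =
      Module.finrank k (S.K i ⟶ N) := by
  symm
  have : Epi (S.π i) := (Rep.epi_iff_surjective _).2 (S.surjective_π _)
  let F : (S.K i ⟶ N) →ₗ[k] (LinearMap.ker ((S.complex.linearYonedaObj k N).d i (i + 1)).hom) :=
    LinearMap.codRestrict _ (Linear.leftComp k N (S.π i)) fun g =>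
      (S.comp_d_eq_zero_iff N i _).2 (by
        change S.ι i ≫ S.π i ≫ g = 0
        rw [← Category.assoc, ι_comp_π, Limits.zero_comp])
  refine (LinearEquiv.ofBijective F ⟨fun g g' h => ?_, fun ⟨f, hf⟩ => ?_⟩).finrank_eq
  · exact (cancel_epi (S.π i)).1 (congrArg Subtype.val h)
  · obtain ⟨g, hg⟩ := Rep.exists_desc (S.surjective_π i) (S.exact i) f
      ((S.comp_d_eq_zero_iff N i f).1 hf)
    exact ⟨g, Subtype.ext hg⟩

/-- Cocycles in degree `j + 1` have the dimension of Hom(K (j + 1), N); coboundaries have dimension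
dim Hom(Q j, N) - dim Hom(K j, N) by rank-nullity. Written additively to avoid subtraction in ℕ. -/
theorem finite_ext_and_finrank [Module.Finite k N] (i : ℕ) : Module.Finite k (S.resolution.ext i N) ∧
    (i = 0 → Module.finrank k (S.resolution.ext i N) = Module.finrank k (S.K 0 ⟶ N)) ∧
    ∀ j, i = j + 1 →
      Module.finrank k (S.resolution.ext i N) + Module.finrank k (S.Q j ⟶ N) =
        Module.finrank k (S.K (j + 1) ⟶ N) + Module.finrank k (S.K j ⟶ N) := by
  let C := S.complex.linearYonedaObj k N
  have hfin : ∀ j, Module.Finite k (C.X j) := fun j => by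
    have := S.finite j
    exact inferInstanceAs (Module.Finite k (S.Q j ⟶ N))
  have key : ∀ a, (ComplexShape.up ℕ).prev i = a → Module.Finite k (C.homology i) ∧
      Module.finrank k (C.homology i) + Module.finrank k (LinearMap.range (C.d a i).hom) =
        Module.finrank k (S.K i ⟶ N) := fun a ha => by
    let e := (ShortComplex.homologyMapIso
      (C.isoSc' a i (i + 1) ha (CochainComplex.next ℕ i))).toLinearEquiv
    have : Module.Finite k (C.sc' a i (i + 1)).X₂ := hfin i
    obtain ⟨h1, h2⟩ := ModuleCat.finrank_homology_add (C.sc' a i (i + 1))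
    refine ⟨Module.Finite.equiv e.symm, ?_⟩
    rw [← S.finrank_ker N i]
    refine Eq.trans ?_ h2
    congr 1
    exact e.finrank_eq
  refine ⟨(key _ rfl).1, ?_, ?_⟩
  · rintro rfl
    -- In degree 0 the predecessor defaults to 0 itself, and the differential from 0 to 0 vanishes,
    -- so there are no coboundaries.
    have h := (key 0 (by simp)).2
    have h0 : Module.finrank k (LinearMap.range (C.d 0 0).hom) = 0 := by
      rw [C.shape 0 0 (by simp)]
      exact (congrArg (fun W : Submodule k _ => Module.finrank k W) LinearMap.range_zero).trans
        (finrank_bot k _)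
    rw [h0] at h
    exact h
  · rintro j rfl
    have h := (key j (by simp)).2
    have := hfin j
    have h' := LinearMap.finrank_range_add_finrank_ker (C.d j (j + 1)).hom
    have h'' : Module.finrank k (C.X j) = Module.finrank k (S.Q j ⟶ N) := rfl
    have h3 : Module.finrank k (S.resolution.ext (j + 1) N) =
      Module.finrank k (C.homology (j + 1)) := rfl
    have h4 := S.finrank_ker N j
    change Module.finrank k (LinearMap.ker (C.d j (j + 1)).hom) = _ at h4
    omega

end RelSyzygies

end Splicing

namespace KleinFour

/-! ### Representations of the Klein four-group as pairs of square-zero operators -/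

section Pairs

variable {k : Type u} [Field k] {G : Type v} [Group G]

/-- A pair of commuting square-zero operators. -/
structure SqZeroPair (k : Type u) [Field k] (V : Type u) [AddCommGroup V] [Module k V] where
  /-- The first operator. -/
  X : V →ₗ[k] V
  /-- The second operator. -/
  Y : V →ₗ[k] V
  XX : ∀ v, X (X v) = 0
  YY : ∀ v, Y (Y v) = 0
  XY : ∀ v, X (Y v) = Y (X v)

/-- The operators `σ - 1` and `τ - 1` of the representation are the given ones. -/
def SqZeroPair.Acts {V : Type u} [AddCommGroup V] [Module k V] (P : SqZeroPair k V) (σ τ : G)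
    (ρ : Representation k G V) : Prop :=
  (∀ v, ρ σ v = v + P.X v) ∧ ∀ v, ρ τ v = v + P.Y v

theorem add_self_eq_zero_of_charTwo [CharP k 2] {V : Type*} [AddCommGroup V] [Module k V] (v : V) :
    v + v = 0 := by
  rw [← two_smul k, CharTwo.two_eq_zero, zero_smul]

theorem eq_of_add_eq_zero_of_charTwo [CharP k 2] {V : Type*} [AddCommGroup V] [Module k V]
    {v w : V} (h : v + w = 0) : v = w := by
  rw [eq_neg_of_add_eq_zero_left h, eq_comm]
  exact eq_neg_of_add_eq_zero_left (add_self_eq_zero_of_charTwo (k := k) w)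

variable {σ τ : G}

theorem SqZeroPair.apply_mul {V : Type u} [AddCommGroup V] [Module k V]
    {P : SqZeroPair k V} {ρ : Representation k G V}
    (h : P.Acts σ τ ρ) (v : V) : ρ (σ * τ) v = v + (P.X v + P.Y v + P.X (P.Y v)) := by
  rw [map_mul, Module.End.mul_apply, h.2, h.1, map_add]
  abel

theorem SqZeroPair.apply_mul_eq_self_iff {V : Type u} [AddCommGroup V] [Module k V]
    {P : SqZeroPair k V} {ρ : Representation k G V}
    (h : P.Acts σ τ ρ) (v : V) : ρ (σ * τ) v = v ↔ P.X v + P.Y v = 0 := by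
  rw [SqZeroPair.apply_mul h, add_eq_left]
  constructor <;> intro hv
  -- Applying X to Xv + Yv + XYv = 0 leaves XYv = 0.
  · have := congrArg P.X hv
    simp only [map_add, P.XX, map_zero, zero_add, add_zero] at this
    rwa [this, add_zero] at hv
  · have := congrArg P.X hv
    simp only [map_add, P.XX, map_zero, zero_add] at this
    rw [hv, this, add_zero]

theorem forall_of_generators [IsKleinFour G] (hσ : σ ≠ 1) (hτ : τ ≠ 1) (hστ : σ ≠ τ)
    {p : G → Prop} (h1 : p 1)
    (hs : p σ) (ht : p τ) (hmul : p (σ * τ)) (g : G) : p g := by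
  by_contra hg
  have h := IsKleinFour.eq_mul_of_ne_all (x := σ) (y := τ) (z := g) hσ hτ hστ
    (by rintro rfl; exact hg h1) (by rintro rfl; exact hg hs) (by rintro rfl; exact hg ht)
  exact hg (h ▸ hmul)

theorem hom_X {A B : Rep.{u} k G} {P : SqZeroPair k A} {P' : SqZeroPair k B}
    (hA : P.Acts σ τ A.ρ) (hB : P'.Acts σ τ B.ρ) (f : A ⟶ B) (v : A) :
    f.hom (P.X v) = P'.X (f.hom v) := by
  have := Rep.hom_comm_apply f σ v
  rwa [hA.1, hB.1, map_add, add_right_inj] at this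

theorem hom_Y {A B : Rep.{u} k G} {P : SqZeroPair k A} {P' : SqZeroPair k B}
    (hA : P.Acts σ τ A.ρ) (hB : P'.Acts σ τ B.ρ) (f : A ⟶ B) (v : A) :
    f.hom (P.Y v) = P'.Y (f.hom v) := by
  have := Rep.hom_comm_apply f τ v
  rwa [hA.2, hB.2, map_add, add_right_inj] at this

variable [CharP k 2] [IsKleinFour G]

section Rep

variable {V : Type u} [AddCommGroup V] [Module k V] (P : SqZeroPair k V)

/-- The representation in which `σ` acts as `1 + X` and `τ` acts as `1 + Y`. -/
def SqZeroPair.rep (hσ : σ ≠ 1) (hτ : τ ≠ 1) (hστ : σ ≠ τ) : Representation k G V where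
  toFun g := (1 + coeff k τ g • P.X) * (1 + coeff k σ g • P.Y)
  map_one' := by simp [coeff]
  map_mul' g h := by
    rw [coeff_mul k hσ hτ hστ, coeff_mul k hτ hσ hστ.symm]
    ext v
    simp only [Module.End.mul_apply, LinearMap.add_apply, Module.End.one_apply,
      LinearMap.smul_apply, map_add, map_smul, P.XX, P.YY, P.XY, smul_zero, map_zero, add_smul,
      smul_add, add_zero, smul_smul]
    module

theorem SqZeroPair.acts_rep (hσ : σ ≠ 1) (hτ : τ ≠ 1) (hστ : σ ≠ τ) :
    P.Acts σ τ (P.rep hσ hτ hστ) := by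
  constructor <;> intro v
  · simp [SqZeroPair.rep, coeff, hσ, hστ]
  · simp [SqZeroPair.rep, coeff, hτ, hστ.symm]

/-- Every element squares to 1, so (g - 1)² = 2(1 - g) = 0 in characteristic two. -/
theorem exists_sqZeroPair (σ τ : G) (ρ : Representation k G V) :
    ∃ P : SqZeroPair k V, P.Acts σ τ ρ := by
  have hg : ∀ (g : G) v, ρ g (ρ g v) = v := fun g v => by
    rw [← Module.End.mul_apply, ← map_mul, IsKleinFour.mul_self, map_one, Module.End.one_apply]
  have hsq : ∀ (g : G) v, (ρ g - 1) ((ρ g - 1) v) = 0 := fun g v => by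
    simp only [LinearMap.sub_apply, map_sub, hg, Module.End.one_apply]
    have := add_self_eq_zero_of_charTwo (k := k) (v - ρ g v)
    rw [← this]
    abel
  have hc : ∀ v, ρ σ (ρ τ v) = ρ τ (ρ σ v) := fun v => by
    rw [← Module.End.mul_apply, ← map_mul, (IsKleinFour.isMulCommutative (G := G)).is_comm.comm,
      map_mul, Module.End.mul_apply]
  refine ⟨⟨ρ σ - 1, ρ τ - 1, hsq σ, hsq τ, fun v => ?_⟩, fun v => ?_, fun v => ?_⟩
  · simp only [LinearMap.sub_apply, map_sub, Module.End.one_apply, hc]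
    abel
  · simp
  · simp

end Rep

section Hom

variable {A B : Rep.{u} k G} {P : SqZeroPair k A} {P' : SqZeroPair k B}

/-- A linear map commuting with the operators is a homomorphism of representations. -/
def homOfCommute (hσ : σ ≠ 1) (hτ : τ ≠ 1) (hστ : σ ≠ τ) (hA : P.Acts σ τ A.ρ)
    (hB : P'.Acts σ τ B.ρ) (f : A →ₗ[k] B) (hX : ∀ v, f (P.X v) = P'.X (f v))
    (hY : ∀ v, f (P.Y v) = P'.Y (f v)) : A ⟶ B :=
  Rep.ofHom ⟨f, fun g => by
    have h1 : f ∘ₗ A.ρ σ = B.ρ σ ∘ₗ f := by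
      ext v
      simp [hA.1, hB.1, hX]
    have h2 : f ∘ₗ A.ρ τ = B.ρ τ ∘ₗ f := by
      ext v
      simp [hA.2, hB.2, hY]
    refine forall_of_generators hσ hτ hστ (p := fun g => f ∘ₗ A.ρ g = B.ρ g ∘ₗ f) ?_ h1 h2 ?_ g
    · rw [map_one, map_one]
      rfl
    · rw [map_mul, map_mul]
      change (f ∘ₗ A.ρ σ) ∘ₗ A.ρ τ = B.ρ σ ∘ₗ B.ρ τ ∘ₗ f
      rw [h1, ← h2]
      rfl⟩

end Hom

end Pairs

/-! ### Sums of permutation modules and free modules, and their relative projectivity -/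

section RelFree

variable (k : Type u) [Field k] {G : Type v} [Group G] (A : Type u) [AddCommGroup A] [Module k A]

/-- The space of `k[G/⟨σ⟩] ⊕ k[G/⟨τ⟩] ⊕ k[G/⟨στ⟩] ⊕ A ⊗ kG`; the components in `A ⊗ kG` are those
with respect to `1, X, Y, XY`. -/
abbrev RelFreeSpace : Type u := (k × k) × (k × k) × (k × k) × (A × A × A × A)

/-- The operators on `k[G/⟨σ⟩] ⊕ k[G/⟨τ⟩] ⊕ k[G/⟨στ⟩] ⊕ A ⊗ kG`. -/
def relFreePair : SqZeroPair k (RelFreeSpace k A) where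
  X :=
    { toFun := fun w => ((0, 0), (0, w.2.1.1), (0, w.2.2.1.1), (0, w.2.2.2.1, 0, w.2.2.2.2.2.1))
      map_add' := fun v w => by simp
      map_smul' := fun c w => by simp }
  Y :=
    { toFun := fun w => ((0, w.1.1), (0, 0), (0, w.2.2.1.1), (0, 0, w.2.2.2.1, w.2.2.2.2.1))
      map_add' := fun v w => by simp
      map_smul' := fun c w => by simp }
  XX _ := rfl
  YY _ := rfl
  XY _ := rfl

theorem relFreePair_X (w : RelFreeSpace k A) : (relFreePair k A).X w =
    ((0, 0), (0, w.2.1.1), (0, w.2.2.1.1), (0, w.2.2.2.1, 0, w.2.2.2.2.2.1)) := rfl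

theorem relFreePair_Y (w : RelFreeSpace k A) : (relFreePair k A).Y w =
    ((0, w.1.1), (0, 0), (0, w.2.2.1.1), (0, 0, w.2.2.2.1, w.2.2.2.2.1)) := rfl

variable [CharP k 2] [IsKleinFour G] {σ τ : G}

/-- The module `k[G/⟨σ⟩] ⊕ k[G/⟨τ⟩] ⊕ k[G/⟨στ⟩] ⊕ A ⊗ kG`. -/
abbrev relFree (hσ : σ ≠ 1) (hτ : τ ≠ 1) (hστ : σ ≠ τ) : Rep.{u} k G :=
  Rep.of ((relFreePair k A).rep hσ hτ hστ)

variable {k A} (hσ : σ ≠ 1) (hτ : τ ≠ 1) (hστ : σ ≠ τ) {N : Rep.{u} k G} {P : SqZeroPair k N}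
  (hP : P.Acts σ τ N.ρ)

/-- The homomorphism with prescribed values on the generators. -/
def relFreeLift (n₁ : LinearMap.ker P.X) (n₂ : LinearMap.ker P.Y) (n₃ : LinearMap.ker (P.X + P.Y))
    (L : A →ₗ[k] N) : relFree k A hσ hτ hστ ⟶ N :=
  homOfCommute hσ hτ hστ ((relFreePair k A).acts_rep hσ hτ hστ) hP
    { toFun := fun w => w.1.1 • n₁.1 + w.1.2 • P.Y n₁ + w.2.1.1 • n₂.1 + w.2.1.2 • P.X n₂ +
        w.2.2.1.1 • n₃.1 + w.2.2.1.2 • P.X n₃ + L w.2.2.2.1 + P.X (L w.2.2.2.2.1) +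
        P.Y (L w.2.2.2.2.2.1) + P.X (P.Y (L w.2.2.2.2.2.2))
      map_add' := fun v w => by
        simp only [Prod.fst_add, Prod.snd_add, map_add, add_smul]
        abel
      map_smul' := fun c w => by
        simp only [Prod.smul_fst, Prod.smul_snd, map_smul, smul_eq_mul, RingHom.id_apply, smul_add,
          mul_smul] }
    (fun w => by
      have h₁ : P.X n₁ = 0 := n₁.2
      simp [relFreePair_X, P.XX, P.XY, h₁])
    (fun w => by
      have h₂ : P.Y n₂ = 0 := n₂.2
      have h₂' : P.Y (P.X n₂) = 0 := by rw [← P.XY, h₂, map_zero]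
      -- X and Y agree on the kernel of X + Y, so one coordinate serves for both translates of the
      -- third generator.
      have h₃ : P.X n₃ = P.Y n₃ := eq_of_add_eq_zero_of_charTwo (k := k) n₃.2
      simp [relFreePair_Y, P.YY, P.XY, h₂, h₂', h₃])

theorem relFreeLift_apply (n₁ : LinearMap.ker P.X) (n₂ : LinearMap.ker P.Y)
    (n₃ : LinearMap.ker (P.X + P.Y)) (L : A →ₗ[k] N) (w : RelFreeSpace k A) :
    (relFreeLift hσ hτ hστ hP n₁ n₂ n₃ L).hom w =
      w.1.1 • n₁.1 + w.1.2 • P.Y n₁ + w.2.1.1 • n₂.1 + w.2.1.2 • P.X n₂ +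
        w.2.2.1.1 • n₃.1 + w.2.2.1.2 • P.X n₃ + L w.2.2.2.1 + P.X (L w.2.2.2.2.1) +
        P.Y (L w.2.2.2.2.2.1) + P.X (P.Y (L w.2.2.2.2.2.2)) := rfl

/-- The values of a homomorphism on the generators. -/
def relFreeData : (relFree k A hσ hτ hστ ⟶ N) →ₗ[k]
    LinearMap.ker P.X × LinearMap.ker P.Y × LinearMap.ker (P.X + P.Y) × (A →ₗ[k] N) where
  toFun φ :=
    ⟨⟨φ.hom ((1, 0), 0), by
      rw [LinearMap.mem_ker, ← hom_X ((relFreePair k A).acts_rep hσ hτ hστ) hP]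
      exact map_zero φ.hom⟩,
     ⟨φ.hom (0, (1, 0), 0), by
      rw [LinearMap.mem_ker, ← hom_Y ((relFreePair k A).acts_rep hσ hτ hστ) hP]
      exact map_zero φ.hom⟩,
     ⟨φ.hom (0, 0, (1, 0), 0), by
      rw [LinearMap.mem_ker, LinearMap.add_apply,
        ← hom_X ((relFreePair k A).acts_rep hσ hτ hστ) hP,
        ← hom_Y ((relFreePair k A).acts_rep hσ hτ hστ) hP]
      exact add_self_eq_zero_of_charTwo (k := k) _⟩,
     { toFun := fun a => φ.hom (0, 0, 0, (a, 0))
       map_add' := fun a b => by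
        rw [← map_add]
        simp
       map_smul' := fun c a => by
        rw [RingHom.id_apply, ← map_smul]
        simp }⟩
  map_add' _ _ := rfl
  map_smul' _ _ := rfl

/-- Frobenius reciprocity: maps out of k[G/H] are H-fixed vectors, and maps out of A ⊗ kG are linear
maps out of A. The vectors fixed by σ, τ and στ are the kernels of X, Y and X + Y. -/
theorem relFreeData_bijective :
    Function.Bijective (relFreeData (A := A) hσ hτ hστ hP) := by
  have hA := (relFreePair k A).acts_rep hσ hτ hστ
  constructor
  · rw [injective_iff_map_eq_zero]
    intro φ h
    let f : RelFreeSpace k A →ₗ[k] N := φ.hom.toLinearMap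
    have hX : ∀ w, f ((relFreePair k A).X w) = P.X (f w) := hom_X hA hP φ
    have hY : ∀ w, f ((relFreePair k A).Y w) = P.Y (f w) := hom_Y hA hP φ
    have hX' : ∀ w, f w = 0 → f ((relFreePair k A).X w) = 0 := fun w hw => by
      rw [hX, hw, map_zero]
    have hY' : ∀ w, f w = 0 → f ((relFreePair k A).Y w) = 0 := fun w hw => by
      rw [hY, hw, map_zero]
    have h₁ : f ((1, 0), 0) = 0 := congrArg (fun d => d.1.1) h
    have h₂ : f (0, (1, 0), 0) = 0 := congrArg (fun d => d.2.1.1) h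
    have h₃ : f (0, 0, (1, 0), 0) = 0 := congrArg (fun d => d.2.2.1.1) h
    have h₄ : ∀ a, f (0, 0, 0, (a, 0)) = 0 := fun a =>
      congrArg (fun d => d.2.2.2 a) h
    have hf : f = 0 := by
      refine LinearMap.prod_ext (LinearMap.prod_ext (LinearMap.ext_ring h₁)
          (LinearMap.ext_ring (hY' _ h₁)))
        (LinearMap.prod_ext (LinearMap.prod_ext (LinearMap.ext_ring h₂)
          (LinearMap.ext_ring (hX' _ h₂)))
        (LinearMap.prod_ext (LinearMap.prod_ext (LinearMap.ext_ring h₃)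
          (LinearMap.ext_ring (hX' _ h₃)))
        (LinearMap.prod_ext (LinearMap.ext h₄) (LinearMap.prod_ext
          (LinearMap.ext fun a => hX' _ (h₄ a)) (LinearMap.prod_ext
          (LinearMap.ext fun a => hY' _ (h₄ a))
          (LinearMap.ext fun a => hX' _ (hY' _ (h₄ a))))))))
    exact Rep.hom_ext (Representation.IntertwiningMap.ext hf)
  · rintro ⟨n₁, n₂, n₃, L⟩
    refine ⟨relFreeLift hσ hτ hστ hP n₁ n₂ n₃ L, ?_⟩
    refine Prod.ext (Subtype.ext ?_) (Prod.ext (Subtype.ext ?_) (Prod.ext (Subtype.ext ?_)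
      (LinearMap.ext fun a => ?_)))
    all_goals
      refine (relFreeLift_apply hσ hτ hστ hP n₁ n₂ n₃ L _).trans ?_
      simp

/-- An H-equivariant section carries H-fixed vectors to H-fixed vectors, which lifts the three
permutation generators. The free part needs only a linear section. -/
theorem isRelProjective_relFree :
    IsRelProjective (chi σ τ) (relFree k A hσ hτ hστ) := by
  intro B C _ _ j φ hj hs
  obtain ⟨P, hP⟩ := exists_sqZeroPair σ τ B.ρ
  obtain ⟨P', hP'⟩ := exists_sqZeroPair σ τ C.ρ
  have hlift : ∀ g : G, Subgroup.zpowers g ∈ chi σ τ → ∀ y, C.ρ g y = y →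
      ∃ x, B.ρ g x = x ∧ j.hom x = y := by
    intro g hg y hy
    obtain ⟨s, hs1, hs2⟩ := hs _ hg
    let y' : LinearMap.range j.hom.toLinearMap := ⟨y, hj y⟩
    exact ⟨s y', (hs2 g (Subgroup.mem_zpowers g) y' y' hy.symm).symm, hs1 y'⟩
  obtain ⟨d, hd⟩ : ∃ d, relFreeData hσ hτ hστ hP' φ = d := ⟨_, rfl⟩
  obtain ⟨⟨n₁, hn₁⟩, ⟨n₂, hn₂⟩, ⟨n₃, hn₃⟩, L⟩ := d
  obtain ⟨m₁, hm₁, rfl⟩ := hlift σ (by simp [chi]) n₁ ((hP'.1 _).trans (by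
    rw [LinearMap.mem_ker.1 hn₁, add_zero]))
  obtain ⟨m₂, hm₂, rfl⟩ := hlift τ (by simp [chi]) n₂ ((hP'.2 _).trans (by
    rw [LinearMap.mem_ker.1 hn₂, add_zero]))
  obtain ⟨m₃, hm₃, rfl⟩ := hlift (σ * τ) (by simp [chi]) n₃
    ((SqZeroPair.apply_mul_eq_self_iff hP' _).2 hn₃)
  obtain ⟨s, hs⟩ := j.hom.toLinearMap.exists_rightInverse_of_surjective
    (LinearMap.range_eq_top.2 hj)
  rw [hP.1, add_eq_left] at hm₁
  rw [hP.2, add_eq_left] at hm₂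
  rw [SqZeroPair.apply_mul_eq_self_iff hP] at hm₃
  obtain ⟨ψ, hψ⟩ := (relFreeData_bijective (A := A) hσ hτ hστ hP).2
    ⟨⟨m₁, hm₁⟩, ⟨m₂, hm₂⟩, ⟨m₃, hm₃⟩, s ∘ₗ L⟩
  refine ⟨ψ, (relFreeData_bijective hσ hτ hστ hP').1 (Eq.trans ?_ hd.symm)⟩
  refine Prod.ext (Subtype.ext ?_) (Prod.ext (Subtype.ext ?_) (Prod.ext (Subtype.ext ?_)
    (LinearMap.ext fun a => ?_)))
  · exact congrArg (fun d => j.hom d.1.1) hψ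
  · exact congrArg (fun d => j.hom d.2.1.1) hψ
  · exact congrArg (fun d => j.hom d.2.2.1.1) hψ
  · exact (congrArg (fun d => j.hom (d.2.2.2 a)) hψ).trans (LinearMap.congr_fun hs (L a))

theorem finrank_relFree_hom (hP : P.Acts σ τ N.ρ) [Module.Finite k A] [Module.Finite k N] :
    Module.finrank k (relFree k A hσ hτ hστ ⟶ N) =
      Module.finrank k (LinearMap.ker P.X) + (Module.finrank k (LinearMap.ker P.Y) +
        (Module.finrank k (LinearMap.ker (P.X + P.Y)) +
          Module.finrank k A * Module.finrank k N)) := by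
  rw [(LinearEquiv.ofBijective _ (relFreeData_bijective (A := A) hσ hτ hστ hP)).finrank_eq,
    Module.finrank_prod, Module.finrank_prod, Module.finrank_prod, Module.finrank_linearMap]

end RelFree

end KleinFour

namespace KleinFour

open Polynomial

/-! ### Polynomials of bounded degree and complements of the images of 1, t and 1 + t -/

section PolynomialMaps

variable (k : Type u) [Field k] (m : ℕ)

theorem mem_degreeLT_iff_coeff {k : Type u} [Field k] {m : ℕ} {f : k[X]} :
    f ∈ degreeLT k m ↔ ∀ j, m ≤ j → f.coeff j = 0 :=
  mem_degreeLT.trans (degree_lt_iff_coeff_zero f m)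

theorem finrank_degreeLT : Module.finrank k (degreeLT k m) = m := by
  rw [Module.finrank_eq_card_basis (degreeLT.basis k m), Fintype.card_fin]

/-- The inclusion of the polynomials of degree less than `m`. -/
def inclLT : degreeLT k m →ₗ[k] degreeLT k (m + 1) :=
  Submodule.inclusion (degreeLT_mono m.le_succ)

/-- Multiplication by the variable. -/
def mulXLT : degreeLT k m →ₗ[k] degreeLT k (m + 1) :=
  (LinearMap.mulLeft k (X : k[X])).restrict fun f hf => by
    rw [mem_degreeLT_iff_coeff] at hf ⊢
    rintro (_ | j) hj
    · simp
    · simpa using hf j (by omega)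

/-- Removal of the coefficient of `X ^ m`. -/
def truncLT : degreeLT k (m + 1) →ₗ[k] degreeLT k m :=
  (LinearMap.id - monomial m ∘ₗ lcoeff k m : k[X] →ₗ[k] k[X]).restrict fun f hf => by
    rw [mem_degreeLT_iff_coeff] at hf ⊢
    intro j hj
    rcases hj.eq_or_lt with rfl | hj
    · simp
    · simp [coeff_monomial, hj.ne, hf j hj]

/-- Division by the variable. -/
def divXLT : degreeLT k (m + 1) →ₗ[k] degreeLT k m :=
  LinearMap.restrict (p := degreeLT k (m + 1)) (q := degreeLT k m)
    { toFun := divX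
      map_add' := fun _ _ => divX_add
      map_smul' := fun c f => by ext; simp } fun f hf => by
    rw [mem_degreeLT_iff_coeff] at hf ⊢
    intro j hj
    simpa using hf (j + 1) (by omega)

/-- The polynomial `X ^ m`. -/
def topLT : degreeLT k (m + 1) :=
  ⟨X ^ m, mem_degreeLT.2 (by rw [degree_X_pow]; exact_mod_cast m.lt_succ_self)⟩

/-- The polynomial `1`. -/
def oneLT : degreeLT k (m + 1) := 
  ⟨1, mem_degreeLT.2 (by rw [degree_one]; exact_mod_cast m.succ_pos)⟩

/-- The coefficient of `X ^ j`. -/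
def coeffLT (j : ℕ) : degreeLT k m →ₗ[k] k := lcoeff k j ∘ₗ Submodule.subtype _

variable {k m}

@[simp] theorem coe_inclLT (f : degreeLT k m) : (inclLT k m f : k[X]) = f :=
  Submodule.coe_inclusion _ _
@[simp] theorem coe_mulXLT (f : degreeLT k m) : (mulXLT k m f : k[X]) = X * (f : k[X]) :=
  rfl
@[simp] theorem coe_truncLT (f : degreeLT k (m + 1)) :
    (truncLT k m f : k[X]) = f - monomial m ((f : k[X]).coeff m) := rfl
@[simp] theorem coe_divXLT (f : degreeLT k (m + 1)) : (divXLT k m f : k[X]) = divX (f : k[X]) := rfl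
@[simp] theorem coe_topLT : (topLT k m : k[X]) = X ^ m := rfl
@[simp] theorem coe_oneLT : (oneLT k m : k[X]) = 1 := rfl
@[simp] theorem coeffLT_apply (j : ℕ) (f : degreeLT k m) : coeffLT k m j f = (f : k[X]).coeff j :=
  rfl

theorem inclLT_injective : Function.Injective (inclLT k m) := Submodule.inclusion_injective _

theorem mulXLT_injective : Function.Injective (mulXLT k m) := fun f g h => by
  have := congrArg Subtype.val h
  simpa using this

theorem X_add_one_ne_zero : (1 + X : k[X]) ≠ 0 := fun h => by
  have := congrArg (fun f : k[X] => f.coeff 1) h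
  simp [coeff_one] at this

theorem inclLT_add_mulXLT_injective : Function.Injective (inclLT k m + mulXLT k m) := by
  rw [injective_iff_map_eq_zero]
  intro f h
  have h' : (1 + X : k[X]) * f = 0 := by
    have := congrArg Subtype.val h
    simpa [add_mul] using this
  exact Subtype.ext ((mul_eq_zero.1 h').resolve_left X_add_one_ne_zero)

/-- The coordinates of a polynomial with respect to a complement of the image of `z`. -/
def complEquiv (z : degreeLT k m →ₗ[k] degreeLT k (m + 1)) (β : degreeLT k (m + 1))
    (h : ∀ (c : k) g, c • β + z g = 0 → c = 0 ∧ g = 0) :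
    (k × degreeLT k m) ≃ₗ[k] degreeLT k (m + 1) :=
  LinearEquiv.ofInjectiveOfFinrankEq ((LinearMap.toSpanSingleton k _ β).coprod z)
    ((injective_iff_map_eq_zero _).2 fun p hp => by
      obtain ⟨h1, h2⟩ := h p.1 p.2 (by simpa using hp)
      exact Prod.ext h1 h2)
    (by rw [Module.finrank_prod, finrank_degreeLT, finrank_degreeLT, Module.finrank_self, add_comm])

theorem complEquiv_apply (z : degreeLT k m →ₗ[k] degreeLT k (m + 1)) (β : degreeLT k (m + 1))
    (h : ∀ (c : k) g, c • β + z g = 0 → c = 0 ∧ g = 0) (p : k × degreeLT k m) :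
    complEquiv z β h p = p.1 • β + z p.2 := rfl

theorem topLT_compl (c : k) (g : degreeLT k m) (h : c • topLT k m + inclLT k m g = 0) :
    c = 0 ∧ g = 0 := by
  have hc : c = 0 := by
    have := congrArg (fun f : degreeLT k (m + 1) => (f : k[X]).coeff m) h
    simpa [mem_degreeLT_iff_coeff.1 g.2 m le_rfl] using this
  refine ⟨hc, inclLT_injective ?_⟩
  simpa [hc] using h

theorem oneLT_compl_mulX (c : k) (g : degreeLT k m) (h : c • oneLT k m + mulXLT k m g = 0) :
    c = 0 ∧ g = 0 := by
  have hc : c = 0 := by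
    have := congrArg (fun f : degreeLT k (m + 1) => (f : k[X]).coeff 0) h
    simpa using this
  refine ⟨hc, mulXLT_injective ?_⟩
  simpa [hc] using h

theorem oneLT_compl_add [CharP k 2] (c : k) (g : degreeLT k m)
    (h : c • oneLT k m + (inclLT k m + mulXLT k m) g = 0) : c = 0 ∧ g = 0 := by
  have hc : c = 0 := by
    -- In characteristic two, evaluation at 1 kills multiples of 1 + X and detects the constant.
    have := congrArg (fun f : degreeLT k (m + 1) => (f : k[X]).eval 1) h
    simpa [CharTwo.add_self_eq_zero] using this
  refine ⟨hc, inclLT_add_mulXLT_injective ?_⟩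
  rw [map_zero]
  simpa [hc] using h

end PolynomialMaps

/-! ### The polynomial model and its relatively projective cover -/

section Modules

variable (k : Type u) [Field k] {G : Type v} [Group G]

/-- A model of the underlying space of `V_{-(2m+1)}`. -/
abbrev PolySpace (m : ℕ) : Type u := degreeLT k m × degreeLT k (m + 1)

/-- The operators on the polynomial model of `V_{-(2m+1)}`. -/
def polyPair (m : ℕ) : SqZeroPair k (PolySpace k m) where
  X := LinearMap.inr k _ _ ∘ₗ inclLT k m ∘ₗ LinearMap.fst k _ _
  Y := LinearMap.inr k _ _ ∘ₗ mulXLT k m ∘ₗ LinearMap.fst k _ _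
  XX v := by simp
  YY v := by simp
  XY v := by simp

theorem polyPair_X (m : ℕ) (v : PolySpace k m) : (polyPair k m).X v = (0, inclLT k m v.1) := rfl
theorem polyPair_Y (m : ℕ) (v : PolySpace k m) : (polyPair k m).Y v = (0, mulXLT k m v.1) := rfl

theorem finrank_polySpace (m : ℕ) : Module.finrank k (PolySpace k m) = 2 * m + 1 := by
  rw [Module.finrank_prod, finrank_degreeLT, finrank_degreeLT]
  ring

/-- Applied to X, Y and X + Y on the polynomial model, all three of which have the second factor as
kernel. -/
theorem finrank_ker_inr_comp {A B : Type u} [AddCommGroup A] [Module k A] [AddCommGroup B]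
    [Module k B] (z : A →ₗ[k] B) (hz : Function.Injective z) (f : A × B →ₗ[k] A × B)
    (hf : ∀ v, f v = (0, z v.1)) :
    Module.finrank k (LinearMap.ker f) = Module.finrank k B := by
  have : LinearMap.ker f = LinearMap.range (LinearMap.inr k A B) := by
    ext ⟨a, b⟩
    rw [LinearMap.mem_ker, hf, LinearMap.range_inr, LinearMap.mem_ker, Prod.mk_eq_zero]
    simp [map_eq_zero_iff z hz]
  rw [this, LinearMap.finrank_range_of_inj LinearMap.inr_injective]

theorem equivariant_zpowers [IsKleinFour G] {A B : Type u} [AddCommGroup A] [Module k A] [AddCommGroup B]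
    [Module k B] (ρ : Representation k G A) (ρ' : Representation k G B) (g : G) (s : A →ₗ[k] B)
    (hs : ∀ v, s (ρ g v) = ρ' g (s v)) (h : G) (hh : h ∈ Subgroup.zpowers g) (v : A) :
    s (ρ h v) = ρ' h (s v) := by
  obtain ⟨n, rfl⟩ := hh
  have hgg : g * g = 1 := IsKleinFour.mul_self g
  have hg2 : ∀ j : ℤ, g ^ (2 * j) = 1 := fun j => by rw [zpow_mul, zpow_two, hgg, one_zpow]
  obtain ⟨j, rfl | rfl⟩ := n.even_or_odd'
  · change s (ρ (g ^ (2 * j)) v) = ρ' (g ^ (2 * j)) (s v)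
    rw [hg2, map_one, map_one, Module.End.one_apply, Module.End.one_apply]
  · change s (ρ (g ^ (2 * j + 1)) v) = ρ' (g ^ (2 * j + 1)) (s v)
    rw [zpow_add_one, hg2, one_mul, hs]

variable [CharP k 2] [IsKleinFour G] {σ τ : G} (hσ : σ ≠ 1) (hτ : τ ≠ 1) (hστ : σ ≠ τ)

/-- The polynomial model of `V_{-(2m+1)}`. -/
abbrev polyRep (m : ℕ) : Rep.{u} k G := Rep.of ((polyPair k m).rep hσ hτ hστ)

theorem finrank_relFree_polyRep (m n : ℕ) :
    Module.finrank k (relFree k (degreeLT k m) hσ hτ hστ ⟶ polyRep k hσ hτ hστ n) =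
      3 * (n + 1) + m * (2 * n + 1) := by
  rw [finrank_relFree_hom hσ hτ hστ ((polyPair k n).acts_rep hσ hτ hστ),
    finrank_ker_inr_comp k (inclLT k n) inclLT_injective _ (polyPair_X k n),
    finrank_ker_inr_comp k (mulXLT k n) mulXLT_injective _ (polyPair_Y k n),
    finrank_ker_inr_comp k (inclLT k n + mulXLT k n) inclLT_add_mulXLT_injective _
      (fun v => by simp [polyPair_X, polyPair_Y]), finrank_degreeLT, finrank_degreeLT]
  have : Module.finrank k (polyRep k hσ hτ hστ n) = 2 * n + 1 := finrank_polySpace k n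
  rw [this]
  ring

/-- The relative projective cover of `V_{-(2m+1)}`. -/
def cover (m : ℕ) : relFree k (degreeLT k m) hσ hτ hστ ⟶ polyRep k hσ hτ hστ m :=
  relFreeLift hσ hτ hστ ((polyPair k m).acts_rep hσ hτ hστ)
    -- The generators go to complements of the images of X, Y and X + Y in the socle: polynomials of
    -- degree < m, multiples of the variable, and multiples of 1 + variable.
    ⟨(0, topLT k m), by simp [polyPair_X]⟩ ⟨(0, oneLT k m), by simp [polyPair_Y]⟩
    ⟨(0, oneLT k m), by simp [polyPair_X, polyPair_Y]⟩ (LinearMap.inl k _ _)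

theorem cover_apply (m : ℕ) (w : RelFreeSpace k (degreeLT k m)) :
    (cover k hσ hτ hστ m).hom w = ((w.2.2.2.1, w.1.1 • topLT k m + w.2.1.1 • oneLT k m +
      w.2.2.1.1 • oneLT k m + inclLT k m w.2.2.2.2.1 + mulXLT k m w.2.2.2.2.2.1) :
        PolySpace k m) := by
  refine (relFreeLift_apply hσ hτ hστ _ _ _ _ _ w).trans ?_
  simp [polyPair_X, polyPair_Y]

/-- For each H, decompose the socle as the chosen complement plus the image of the matching
operator. The complement lifts to k[G/H], and the tops with their translates lift to the free part.
-/
theorem cover_split (m : ℕ) (H : Subgroup G) (hH : H ∈ chi σ τ) :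
    ∃ s : polyRep k hσ hτ hστ m →ₗ[k] relFree k (degreeLT k m) hσ hτ hστ,
      (∀ y, (cover k hσ hτ hστ m).hom (s y) = y) ∧ ∀ h ∈ H, ∀ y,
        s ((polyRep k hσ hτ hστ m).ρ h y) =
          (relFree k (degreeLT k m) hσ hτ hστ).ρ h (s y) := by
  have hA := (polyPair k m).acts_rep hσ hτ hστ
  have hB := (relFreePair k (degreeLT k m)).acts_rep hσ hτ hστ
  rcases hH with rfl | rfl | rfl
  · let e := complEquiv (inclLT k m) (topLT k m) topLT_compl
    have he : ∀ b, (e.symm b).1 • topLT k m + inclLT k m (e.symm b).2 = b := e.apply_symm_apply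
    have he' : ∀ a, e.symm (inclLT k m a) = (0, a) := fun a => by
      rw [e.symm_apply_eq]
      simp [e, complEquiv_apply]
    let s : PolySpace k m →ₗ[k] RelFreeSpace k (degreeLT k m) :=
      { toFun := fun v => (((e.symm v.2).1, 0), 0, 0, (v.1, (e.symm v.2).2, 0, 0))
        map_add' := fun v w => by simp
        map_smul' := fun c w => by simp }
    refine ⟨s, fun y => ?_, equivariant_zpowers k _ _ _ s fun v => ?_⟩
    · refine (cover_apply k hσ hτ hστ m _).trans ?_
      refine Prod.ext rfl ?_
      simpa [s] using he y.2
    · refine (congrArg s (hA.1 v)).trans (Eq.trans ?_ (hB.1 (s v)).symm)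
      rw [map_add]
      congr 1
      simp [s, polyPair_X, relFreePair_X, he']
      rfl
  · let e := complEquiv (mulXLT k m) (oneLT k m) oneLT_compl_mulX
    have he : ∀ b, (e.symm b).1 • oneLT k m + mulXLT k m (e.symm b).2 = b := e.apply_symm_apply
    have he' : ∀ a, e.symm (mulXLT k m a) = (0, a) := fun a => by
      rw [e.symm_apply_eq]
      simp [e, complEquiv_apply]
    let s : PolySpace k m →ₗ[k] RelFreeSpace k (degreeLT k m) :=
      { toFun := fun v => (0, ((e.symm v.2).1, 0), 0, (v.1, 0, (e.symm v.2).2, 0))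
        map_add' := fun v w => by simp
        map_smul' := fun c w => by simp }
    refine ⟨s, fun y => ?_, equivariant_zpowers k _ _ _ s fun v => ?_⟩
    · refine (cover_apply k hσ hτ hστ m _).trans ?_
      refine Prod.ext rfl ?_
      simpa [s] using he y.2
    · refine (congrArg s (hA.2 v)).trans (Eq.trans ?_ (hB.2 (s v)).symm)
      rw [map_add]
      congr 1
      simp [s, polyPair_Y, relFreePair_Y, he']
      rfl
  · let e := complEquiv (inclLT k m + mulXLT k m) (oneLT k m) oneLT_compl_add
    have he : ∀ b, (e.symm b).1 • oneLT k m + (inclLT k m (e.symm b).2 +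
        mulXLT k m (e.symm b).2) = b := e.apply_symm_apply
    have he' : ∀ a, e.symm (inclLT k m a + mulXLT k m a) = (0, a) := fun a => by
      rw [e.symm_apply_eq]
      simp [e, complEquiv_apply]
    -- On the free part στ - 1 = X + Y + XY, hence the same entry in all three of these coordinates.
    let s : PolySpace k m →ₗ[k] RelFreeSpace k (degreeLT k m) :=
      { toFun := fun v => (0, 0, ((e.symm v.2).1, 0),
          (v.1, (e.symm v.2).2, (e.symm v.2).2, (e.symm v.2).2))
        map_add' := fun v w => by simp
        map_smul' := fun c w => by simp }
    refine ⟨s, fun y => ?_, equivariant_zpowers k _ _ _ s fun v => ?_⟩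
    · refine (cover_apply k hσ hτ hστ m _).trans ?_
      refine Prod.ext rfl ?_
      simpa [s, add_assoc] using he y.2
    · refine (congrArg s (SqZeroPair.apply_mul hA v)).trans
        (Eq.trans ?_ (SqZeroPair.apply_mul hB (s v)).symm)
      rw [map_add]
      congr 1
      simp [s, polyPair_X, polyPair_Y, relFreePair_X, relFreePair_Y, he',
        CharTwo.add_self_eq_zero]
      exact ⟨rfl, add_self_eq_zero_of_charTwo (k := k) _⟩

end Modules

end KleinFour

namespace KleinFour

open Polynomial

/-! ### The relative syzygy of `V_{-(2m+1)}` is `V_{-(2m+5)}` -/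

section Syzygy

variable (k : Type u) [Field k]

theorem coeff_last_eq_zero (m : ℕ) (g : degreeLT k m) : (g : k[X]).coeff m = 0 :=
  mem_degreeLT_iff_coeff.1 g.2 m le_rfl

theorem divXLT_smul_add_mulXLT (m : ℕ) (c : k) (g : degreeLT k m) :
    divXLT k m (c • oneLT k m + mulXLT k m g) = g := by
  refine Subtype.ext (Polynomial.ext fun j => ?_)
  simp

theorem truncLT_divXLT_inclLT (m : ℕ) (g : degreeLT k (m + 1)) :
    truncLT k m (divXLT k (m + 1) (inclLT k (m + 1) g)) = divXLT k m g := by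
  refine Subtype.ext ?_
  simp [coeff_last_eq_zero k (m + 1) g]

variable [CharP k 2]

/-- The decomposition `f = c + (1 + X) g`. -/
def oneAddXEquiv (m : ℕ) : (k × degreeLT k m) ≃ₗ[k] degreeLT k (m + 1) :=
  complEquiv (inclLT k m + mulXLT k m) (oneLT k m) oneLT_compl_add

theorem coe_oneAddXEquiv (m : ℕ) (p : k × degreeLT k m) :
    (oneAddXEquiv k m p : k[X]) = C p.1 + ((p.2 : k[X]) + X * (p.2 : k[X])) := by
  simp [oneAddXEquiv, complEquiv_apply, smul_eq_C_mul]

theorem oneAddXEquiv_symm_incl (m : ℕ) (p : k × degreeLT k m) :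
    (oneAddXEquiv k (m + 1)).symm (inclLT k (m + 1) (oneAddXEquiv k m p)) =
      (p.1, inclLT k m p.2) := by
  rw [LinearEquiv.symm_apply_eq]
  refine Subtype.ext ?_
  simp only [coe_inclLT, coe_oneAddXEquiv]

/-- In characteristic two, X(c + (1 + X)g) = c + (1 + X)(c + Xg). -/
theorem oneAddXEquiv_symm_mulX (m : ℕ) (p : k × degreeLT k m) :
    (oneAddXEquiv k (m + 1)).symm (mulXLT k (m + 1) (oneAddXEquiv k m p)) =
      (p.1, p.1 • oneLT k m + mulXLT k m p.2) := by
  rw [LinearEquiv.symm_apply_eq]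
  refine Subtype.ext ?_
  have h := CharTwo.add_self_eq_zero (C p.1)
  simp only [coe_mulXLT, coe_oneAddXEquiv, Submodule.coe_add, Submodule.coe_smul, coe_oneLT,
    smul_eq_C_mul, mul_one]
  linear_combination -h

/-- The underlying linear map of the inclusion of the relative syzygy. -/
def syzygyMap (m : ℕ) : PolySpace k (m + 2) →ₗ[k] RelFreeSpace k (degreeLT k m) where
  toFun v :=
    -- With `v.1` = c + (1 + X)g, the entries come from writing g twice, as (top term) +
    -- (truncation) and as (constant) + X · (quotient). The sum of the two vanishes, which is a
    -- relation among the images of the generators.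
    ((coeffLT k _ m ((oneAddXEquiv k (m + 1)).symm v.1).2,
      coeffLT k _ (m + 1) ((oneAddXEquiv k (m + 2)).symm v.2).2),
     (((oneAddXEquiv k (m + 1)).symm v.1).1 +
        coeffLT k _ 0 ((oneAddXEquiv k (m + 1)).symm v.1).2,
      ((oneAddXEquiv k (m + 2)).symm v.2).1 +
        coeffLT k _ 0 ((oneAddXEquiv k (m + 2)).symm v.2).2),
     (((oneAddXEquiv k (m + 1)).symm v.1).1, ((oneAddXEquiv k (m + 2)).symm v.2).1),
     (0, truncLT k m ((oneAddXEquiv k (m + 1)).symm v.1).2,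
      divXLT k m ((oneAddXEquiv k (m + 1)).symm v.1).2,
      truncLT k m (divXLT k (m + 1) ((oneAddXEquiv k (m + 2)).symm v.2).2)))
  map_add' v w := by
    simp only [Prod.fst_add, Prod.snd_add, map_add, Prod.mk_add_mk, Prod.mk.injEq, true_and,
      add_zero, and_true]
    constructor <;> abel
  map_smul' c w := by
    simp only [Prod.smul_fst, Prod.smul_snd, map_smul, Prod.smul_mk, smul_eq_mul, mul_add,
      RingHom.id_apply, smul_zero]

theorem syzygyMap_apply (m : ℕ) (p : k × degreeLT k (m + 1)) (q : k × degreeLT k (m + 2)) :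
    syzygyMap k m (oneAddXEquiv k (m + 1) p, oneAddXEquiv k (m + 2) q) =
      (((p.2 : k[X]).coeff m, (q.2 : k[X]).coeff (m + 1)),
       (p.1 + (p.2 : k[X]).coeff 0, q.1 + (q.2 : k[X]).coeff 0), (p.1, q.1),
       (0, truncLT k m p.2, divXLT k m p.2, truncLT k m (divXLT k (m + 1) q.2))) := by
  simp [syzygyMap]

theorem syzygyMap_injective (m : ℕ) : Function.Injective (syzygyMap k m) := by
  rw [injective_iff_map_eq_zero]
  rintro ⟨a, b⟩ h
  obtain ⟨p, rfl⟩ := (oneAddXEquiv k (m + 1)).surjective a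
  obtain ⟨q, rfl⟩ := (oneAddXEquiv k (m + 2)).surjective b
  rw [syzygyMap_apply] at h
  simp only [Prod.mk_eq_zero, true_and] at h
  obtain ⟨⟨h1, h2⟩, ⟨h3, h4⟩, ⟨h5, h6⟩, h7, h8, h9⟩ := h
  have hp : p = 0 := by
    refine Prod.ext h5 (Subtype.ext ?_)
    have := congrArg Subtype.val h7
    simpa [h1] using this
  have hq : q = 0 := by
    refine Prod.ext h6 (Subtype.ext ?_)
    have h10 := congrArg Subtype.val h9
    rw [coe_truncLT, coe_divXLT, coeff_divX, h2, monomial_zero_right, sub_zero] at h10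
    rw [h6, zero_add] at h4
    have := divX_mul_X_add (q.2 : k[X])
    rw [h10, h4] at this
    simpa using this.symm
  simp [hp, hq]

variable {k} {G : Type v} [Group G] [IsKleinFour G] {σ τ : G} (hσ : σ ≠ 1) (hτ : τ ≠ 1)
  (hστ : σ ≠ τ)

/-- The inclusion of `V_{-(2m+5)}` as the relative syzygy of `V_{-(2m+1)}`. -/
def syzygyInclusion (m : ℕ) :
    polyRep k hσ hτ hστ (m + 2) ⟶ relFree k (degreeLT k m) hσ hτ hστ :=
  homOfCommute hσ hτ hστ ((polyPair k (m + 2)).acts_rep hσ hτ hστ)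
    ((relFreePair k (degreeLT k m)).acts_rep hσ hτ hστ) (syzygyMap k m)
    (fun v => by
      obtain ⟨a, b⟩ := v
      obtain ⟨p, rfl⟩ := (oneAddXEquiv k (m + 1)).surjective a
      obtain ⟨q, rfl⟩ := (oneAddXEquiv k (m + 2)).surjective b
      have h : ((polyPair k (m + 2)).X (oneAddXEquiv k (m + 1) p, oneAddXEquiv k (m + 2) q)) =
          (oneAddXEquiv k (m + 1) 0, oneAddXEquiv k (m + 2) (p.1, inclLT k _ p.2)) := by
        rw [polyPair_X, map_zero, ← oneAddXEquiv_symm_incl, LinearEquiv.apply_symm_apply]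
      rw [h, syzygyMap_apply, syzygyMap_apply, relFreePair_X]
      simp [coeff_last_eq_zero k (m + 1) p.2, truncLT_divXLT_inclLT])
    (fun v => by
      obtain ⟨a, b⟩ := v
      obtain ⟨p, rfl⟩ := (oneAddXEquiv k (m + 1)).surjective a
      obtain ⟨q, rfl⟩ := (oneAddXEquiv k (m + 2)).surjective b
      have h : ((polyPair k (m + 2)).Y (oneAddXEquiv k (m + 1) p, oneAddXEquiv k (m + 2) q)) =
          (oneAddXEquiv k (m + 1) 0, oneAddXEquiv k (m + 2)
            (p.1, p.1 • oneLT k _ + mulXLT k _ p.2)) := by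
        rw [polyPair_Y, map_zero, ← oneAddXEquiv_symm_mulX, LinearEquiv.apply_symm_apply]
      rw [h, syzygyMap_apply, syzygyMap_apply, relFreePair_Y, divXLT_smul_add_mulXLT]
      simp [coeff_one, CharTwo.add_self_eq_zero])

theorem surjective_cover (m : ℕ) : Function.Surjective (cover k hσ hτ hστ m).hom := fun y => by
  obtain ⟨s, hs, -⟩ := cover_split k hσ hτ hστ m (Subgroup.zpowers σ) (by simp [chi])
  exact ⟨s y, hs y⟩

theorem cover_syzygyMap (m : ℕ) (v : PolySpace k (m + 2)) :
    (cover k hσ hτ hστ m).hom (syzygyMap k m v) = 0 := by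
  obtain ⟨a, b⟩ := v
  obtain ⟨p, rfl⟩ := (oneAddXEquiv k (m + 1)).surjective a
  obtain ⟨q, rfl⟩ := (oneAddXEquiv k (m + 2)).surjective b
  rw [syzygyMap_apply]
  refine (cover_apply k hσ hτ hστ m _).trans (Prod.ext rfl (Subtype.ext ?_))
  have h1 := divX_mul_X_add (p.2 : k[X])
  have h2 := CharTwo.add_self_eq_zero (C p.1)
  have h3 := CharTwo.add_self_eq_zero (p.2 : k[X])
  simp only [Submodule.coe_add, Submodule.coe_smul, coe_topLT, coe_oneLT, smul_eq_C_mul,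
    coe_inclLT, coe_mulXLT, coe_truncLT, coe_divXLT, ← C_mul_X_pow_eq_monomial, C_add]
  change _ = (0 : k[X])
  -- The two expansions of g cancel, and so do the two copies of the constant `p.1`.
  linear_combination h1 + h2 + h3

theorem exact_syzygyInclusion_cover (m : ℕ) :
    Function.Exact (syzygyInclusion (k := k) hσ hτ hστ m).hom (cover k hσ hτ hστ m).hom := by
  let f : RelFreeSpace k (degreeLT k m) →ₗ[k] PolySpace k m :=
    (cover k hσ hτ hστ m).hom.toLinearMap
  suffices h : LinearMap.range (syzygyMap k m) = LinearMap.ker f by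
    exact LinearMap.exact_iff.2 h.symm
  refine Submodule.eq_of_le_of_finrank_eq ?_ ?_
  · rintro _ ⟨v, rfl⟩
    exact cover_syzygyMap hσ hτ hστ m v
  · have h := LinearMap.finrank_range_add_finrank_ker f
    rw [LinearMap.range_eq_top.2 (surjective_cover hσ hτ hστ m), finrank_top,
      finrank_polySpace] at h
    -- Dimensions match: (6 + 4m) - (2m + 1) = 2(m + 2) + 1.
    rw [LinearMap.finrank_range_of_inj (syzygyMap_injective k m), finrank_polySpace]
    simp only [Module.finrank_prod, Module.finrank_self, finrank_degreeLT] at h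
    omega

/-- The polynomial model of `V_{-1}` is the trivial module. -/
theorem nonempty_polyRep_zero_iso :
    Nonempty (polyRep k hσ hτ hστ 0 ≅ Rep.trivial k G k) := by
  let P : SqZeroPair k k := ⟨0, 0, fun _ => rfl, fun _ => rfl, fun _ => rfl⟩
  have hP : P.Acts σ τ (Rep.trivial k G k).ρ :=
    ⟨fun v => (add_zero v).symm, fun v => (add_zero v).symm⟩
  have h0 : ∀ f : degreeLT k 0, f = 0 := fun f =>
    Subtype.ext (Polynomial.ext fun j => mem_degreeLT_iff_coeff.1 f.2 j j.zero_le)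
  let f : PolySpace k 0 →ₗ[k] k := coeffLT k 1 0 ∘ₗ LinearMap.snd k _ _
  let φ : polyRep k hσ hτ hστ 0 ⟶ Rep.trivial k G k :=
    homOfCommute hσ hτ hστ ((polyPair k 0).acts_rep hσ hτ hστ) hP f
      (fun v => by simp [f, P, polyPair_X, h0]) (fun v => by simp [f, P, polyPair_Y])
  have : Mono φ := (Rep.mono_iff_injective _).2 fun v w h => by
    refine Prod.ext ((h0 _).trans (h0 _).symm) (Subtype.ext (Polynomial.ext fun j => ?_))
    rcases j with _ | j
    · exact h
    · rw [mem_degreeLT_iff_coeff.1 v.2.2 _ (by omega), mem_degreeLT_iff_coeff.1 w.2.2 _ (by omega)]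
  have : Epi φ := (Rep.epi_iff_surjective _).2 fun c =>
    ⟨(0, c • oneLT k 0), by
      change coeffLT k 1 0 (c • oneLT k 0) = c
      simp⟩
  have := isIso_of_mono_of_epi φ
  exact ⟨asIso φ⟩

/-- The relative syzygies of the trivial module. -/
def trivialSyzygies : RelSyzygies (chi σ τ) (Rep.trivial k G k) where
  K i := polyRep k hσ hτ hστ (2 * i)
  Q i := relFree k (degreeLT k (2 * i)) hσ hτ hστ
  ι i := syzygyInclusion hσ hτ hστ (2 * i)
  π i := cover k hσ hτ hστ (2 * i)
  e := (nonempty_polyRep_zero_iso hσ hτ hστ).some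
  finite i := inferInstanceAs (Module.Finite k (RelFreeSpace k (degreeLT k (2 * i))))
  relProjective _ := isRelProjective_relFree hσ hτ hστ
  injective_ι i := syzygyMap_injective k (2 * i)
  surjective_π i := surjective_cover hσ hτ hστ (2 * i)
  exact i := exact_syzygyInclusion_cover hσ hτ hστ (2 * i)
  split i := cover_split k hσ hτ hστ (2 * i)

end Syzygy

end KleinFour

namespace KleinFour

open Polynomial

/-! ### Homomorphisms between the modules `V_{-(2m+1)}` -/

section Homs

variable {k : Type u} [Field k]

theorem mul_mem_degreeLT {m n r : ℕ} (h : r ≠ 0 → m + r ≤ n + 1) {p f : k[X]}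
    (hp : p ∈ degreeLT k r) (hf : f ∈ degreeLT k m) : p * f ∈ degreeLT k n := by
  rw [mem_degreeLT] at hp hf ⊢
  by_cases hp0 : p = 0
  · simp [hp0]
  by_cases hf0 : f = 0
  · simp [hf0]
  rw [← natDegree_lt_iff_degree_lt hp0] at hp
  rw [← natDegree_lt_iff_degree_lt hf0] at hf
  rw [← natDegree_lt_iff_degree_lt (mul_ne_zero hp0 hf0), natDegree_mul hp0 hf0]
  omega

variable (k) in
/-- Multiplication of polynomials of bounded degree. -/
def mulLT {m n r : ℕ} (h : r ≠ 0 → m + r ≤ n + 1) :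
    degreeLT k r →ₗ[k] degreeLT k m →ₗ[k] degreeLT k n :=
  LinearMap.mk₂ k (fun p f => ⟨(p : k[X]) * (f : k[X]), mul_mem_degreeLT h p.2 f.2⟩)
    (fun _ _ _ => Subtype.ext (add_mul _ _ _)) (fun _ _ _ => Subtype.ext (smul_mul_assoc _ _ _))
    (fun _ _ _ => Subtype.ext (mul_add _ _ _)) (fun _ _ _ => Subtype.ext (mul_smul_comm _ _ _))

variable (k) in
/-- The map of polynomial models given by a polynomial and a linear map from the top of the first
to the socle of the second. -/
def polyMap (m n : ℕ) : (degreeLT k (n + 1 - m) × (degreeLT k m →ₗ[k] degreeLT k (n + 1))) →ₗ[k]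
    (PolySpace k m →ₗ[k] PolySpace k n) where
  -- If m > n, the truncated n + 1 - m is 0 and the polynomial is forced to vanish; the proviso `r ≠
  -- 0` in `mulLT` covers this case.
  toFun d := ((mulLT k (by omega) d.1).comp (LinearMap.fst k _ _)).prod
    ((mulLT k (by omega) d.1).comp (LinearMap.snd k _ _) + d.2.comp (LinearMap.fst k _ _))
  map_add' d d' := by
    refine LinearMap.ext fun v => Prod.ext ?_ ?_
    · simp
    · change mulLT k (by omega) (d.1 + d'.1) v.2 + (d.2 + d'.2) v.1 =
        (mulLT k (by omega) d.1 v.2 + d.2 v.1) + (mulLT k (by omega) d'.1 v.2 + d'.2 v.1)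
      rw [map_add, LinearMap.add_apply, LinearMap.add_apply, add_add_add_comm]
  map_smul' c d := by
    refine LinearMap.ext fun v => Prod.ext ?_ ?_ <;> simp

theorem polyMap_fst {m n : ℕ} (d) (v : PolySpace k m) :
    ((polyMap k m n d v).1 : k[X]) = d.1 * (v.1 : k[X]) := rfl

theorem polyMap_snd {m n : ℕ} (d) (v : PolySpace k m) :
    ((polyMap k m n d v).2 : k[X]) = d.1 * (v.2 : k[X]) + (d.2 v.1 : k[X]) := rfl

theorem polyMap_injective (m n : ℕ) : Function.Injective (polyMap k m n) := by
  rw [injective_iff_map_eq_zero]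
  rintro ⟨p, L⟩ h
  have hp : p = 0 := by
    have := polyMap_snd (p, L) ((0, oneLT k m) : PolySpace k m)
    rw [h] at this
    exact Subtype.ext (by simpa using this.symm)
  refine Prod.ext hp (LinearMap.ext fun a => Subtype.ext ?_)
  have := polyMap_snd (p, L) ((a, 0) : PolySpace k m)
  rw [h, hp] at this
  simpa using this.symm

/-- Splitting off constant terms repeatedly shows that every value of `D` is divisible by all powers
of X. -/
theorem eq_zero_of_map_mulX {m : ℕ} (D : degreeLT k (m + 1) →ₗ[k] k[X])
    (h1 : D (oneLT k m) = 0) (h : ∀ a, D (mulXLT k m a) = X * D (inclLT k m a)) : D = 0 := by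
  have key : ∀ (d : ℕ) f, X ^ d ∣ D f := by
    intro d
    induction d with
    | zero => simp
    | succ d ih =>
      intro f
      have hf : f = (f : k[X]).coeff 0 • oneLT k m + mulXLT k m (divXLT k m f) := by
        refine Subtype.ext ?_
        have := divX_mul_X_add (f : k[X])
        simp only [Submodule.coe_add, Submodule.coe_smul, coe_oneLT, coe_mulXLT, coe_divXLT,
          smul_eq_C_mul, mul_one]
        linear_combination -this
      rw [hf, map_add, map_smul, h1, smul_zero, zero_add, h, pow_succ']
      exact mul_dvd_mul_left _ (ih _)
  refine LinearMap.ext fun f => Polynomial.ext fun j => ?_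
  exact X_pow_dvd_iff.1 (key (j + 1) f) j j.lt_succ_self

/-- Commuting with both operators makes `f` compatible with multiplication by the variable on
socles. There it is multiplication by p, the image of 1, and the same p governs the tops. -/
theorem exists_polyMap_eq {m n : ℕ} (f : PolySpace k m →ₗ[k] PolySpace k n)
    (hX : ∀ v, f ((polyPair k m).X v) = (polyPair k n).X (f v))
    (hY : ∀ v, f ((polyPair k m).Y v) = (polyPair k n).Y (f v)) : ∃ d, polyMap k m n d = f := by
  have h1 : ∀ b, (f (0, b)).1 = 0 := fun b => by
    have := hX (0, b)
    rw [polyPair_X, polyPair_X, map_zero, Prod.mk_zero_zero, map_zero] at this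
    exact inclLT_injective ((congrArg Prod.snd this).symm.trans (map_zero _).symm)
  have h2 : ∀ a, f (0, inclLT k m a) = (0, inclLT k n (f (a, 0)).1) := fun a => hX (a, 0)
  have h3 : ∀ a, f (0, mulXLT k m a) = (0, mulXLT k n (f (a, 0)).1) := fun a => hY (a, 0)
  let p : k[X] := (f (0, oneLT k m)).2
  let D : degreeLT k (m + 1) →ₗ[k] k[X] :=
    Submodule.subtype _ ∘ₗ LinearMap.snd k _ _ ∘ₗ f ∘ₗ LinearMap.inr k _ _ -
      LinearMap.mulLeft k p ∘ₗ Submodule.subtype _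
  have hD : ∀ b, D b = ((f (0, b)).2 : k[X]) - p * (b : k[X]) := fun b => rfl
  have hD0 : D = 0 := by
    refine eq_zero_of_map_mulX D ?_ fun a => ?_
    · rw [hD]
      simp [p]
    · rw [hD, hD, h2, h3]
      simp only [coe_mulXLT, coe_inclLT]
      ring
  have h4 : ∀ b, ((f (0, b)).2 : k[X]) = p * (b : k[X]) := fun b =>
    sub_eq_zero.1 ((hD b).symm.trans (LinearMap.congr_fun hD0 b))
  have hp : p ∈ degreeLT k (n + 1 - m) := by
    rw [mem_degreeLT_iff_coeff]
    intro j hj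
    -- p · X^m is the image of X^m, hence of degree at most n; this bounds the degree of p.
    rw [← coeff_mul_X_pow p m j]
    have := h4 (topLT k m)
    rw [coe_topLT] at this
    rw [← this]
    exact mem_degreeLT_iff_coeff.1 (f (0, topLT k m)).2.2 _ (by omega)
  refine ⟨(⟨p, hp⟩, LinearMap.snd k _ _ ∘ₗ f ∘ₗ LinearMap.inl k _ _), LinearMap.ext fun v => ?_⟩
  have hv : f v = f (v.1, 0) + f (0, v.2) := by
    rw [← map_add]
    simp
  have h5 : ((f (v.1, 0)).1 : k[X]) = p * (v.1 : k[X]) := by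
    have := h4 (inclLT k m v.1)
    rw [h2] at this
    simpa using this
  refine Prod.ext (Subtype.ext ?_) (Subtype.ext ?_)
  · rw [polyMap_fst, hv, Prod.fst_add, h1, add_zero, h5]
  · rw [polyMap_snd, hv, Prod.snd_add, Submodule.coe_add, h4 v.2, add_comm]
    rfl

variable [CharP k 2] {G : Type v} [Group G] [IsKleinFour G] {σ τ : G} (hσ : σ ≠ 1) (hτ : τ ≠ 1)
  (hστ : σ ≠ τ)

theorem finrank_polyRep_hom (m n : ℕ) :
    Module.finrank k (polyRep k hσ hτ hστ m ⟶ polyRep k hσ hτ hστ n) =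
      (n + 1 - m) + m * (n + 1) := by
  let T : (polyRep k hσ hτ hστ m ⟶ polyRep k hσ hτ hστ n) →ₗ[k]
      PolySpace k m →ₗ[k] PolySpace k n :=
    { toFun := fun φ => φ.hom.toLinearMap
      map_add' := fun _ _ => rfl
      map_smul' := fun _ _ => rfl }
  have hT : Function.Injective T := fun φ ψ h =>
    Rep.hom_ext (Representation.IntertwiningMap.ext h)
  have hA := fun m => (polyPair k m).acts_rep hσ hτ hστ
  have hr : LinearMap.range T = LinearMap.range (polyMap k m n) := by
    ext f
    constructor
    · rintro ⟨φ, rfl⟩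
      exact exists_polyMap_eq _ (hom_X (hA m) (hA n) φ) (hom_Y (hA m) (hA n) φ)
    · rintro ⟨d, rfl⟩
      refine ⟨homOfCommute hσ hτ hστ (hA m) (hA n) (polyMap k m n d) (fun v => ?_) fun v => ?_, rfl⟩
      · refine Prod.ext (Subtype.ext ?_) (Subtype.ext ?_)
        · rw [polyMap_fst, polyPair_X, polyPair_X]
          exact mul_zero _
        · rw [polyMap_snd, polyPair_X, polyPair_X, coe_inclLT, coe_inclLT, polyMap_fst, map_zero]
          exact add_zero _
      · refine Prod.ext (Subtype.ext ?_) (Subtype.ext ?_)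
        · rw [polyMap_fst, polyPair_Y, polyPair_Y]
          exact mul_zero _
        · rw [polyMap_snd, polyPair_Y, polyPair_Y, coe_mulXLT, coe_mulXLT, polyMap_fst, map_zero,
            mul_left_comm]
          exact add_zero _
  rw [← LinearMap.finrank_range_of_inj hT, hr,
    LinearMap.finrank_range_of_inj (polyMap_injective m n), Module.finrank_prod,
    Module.finrank_linearMap, finrank_degreeLT, finrank_degreeLT, finrank_degreeLT]

theorem nonempty_VNeg_iso_polyRep (n : ℕ) :
    Nonempty (VNeg k (n := n) hσ hτ hστ ≅ polyRep k hσ hτ hστ n) := by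
  let P : SqZeroPair k (NegSpace k n) :=
    ⟨negX k n, negY k n, LinearMap.congr_fun (negX_mul_negX k n),
      LinearMap.congr_fun (negY_mul_negY k n), fun v =>
      (LinearMap.congr_fun (negX_mul_negY k n) v).trans
        (LinearMap.congr_fun (negY_mul_negX k n) v).symm⟩
  have hP : P.Acts σ τ (VNeg k (n := n) hσ hτ hστ).ρ :=
    ⟨LinearMap.congr_fun (negRep_left k n hσ hτ hστ),
      LinearMap.congr_fun (negRep_right k n hσ hτ hστ)⟩
  let B := (degreeLT.basis k n).prod (degreeLT.basis k (n + 1))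
  let e := B.repr.symm
  have ha : ∀ j, e (a k j) = (degreeLT.basis k n j, 0) := fun j => by
    simp [e, a, B]
  have hb : ∀ j, e (b k j) = (0, degreeLT.basis k (n + 1) j) := fun j => by
    simp [e, b, B]
  have hX : e.toLinearMap ∘ₗ negX k n = (polyPair k n).X ∘ₗ e.toLinearMap := by
    ext1 (j | j) <;> refine LinearMap.ext_ring ?_
    · change e (negX k n (a k j)) = (polyPair k n).X (e (a k j))
      rw [negX_a, hb, ha, polyPair_X]
      refine Prod.ext rfl (Subtype.ext ?_)
      simp
    · change e (negX k n (b k j)) = (polyPair k n).X (e (b k j))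
      rw [negX_b, hb, polyPair_X, map_zero, map_zero]
      rfl
  have hY : e.toLinearMap ∘ₗ negY k n = (polyPair k n).Y ∘ₗ e.toLinearMap := by
    ext1 (j | j) <;> refine LinearMap.ext_ring ?_
    · change e (negY k n (a k j)) = (polyPair k n).Y (e (a k j))
      rw [negY_a, hb, ha, polyPair_Y]
      refine Prod.ext rfl (Subtype.ext ?_)
      simp [pow_succ']
    · change e (negY k n (b k j)) = (polyPair k n).Y (e (b k j))
      rw [negY_b, hb, polyPair_Y, map_zero, map_zero]
      rfl
  let φ : VNeg k (n := n) hσ hτ hστ ⟶ polyRep k hσ hτ hστ n :=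
    homOfCommute hσ hτ hστ hP ((polyPair k n).acts_rep hσ hτ hστ) e.toLinearMap
      (LinearMap.congr_fun hX) (LinearMap.congr_fun hY)
  have : Mono φ := (Rep.mono_iff_injective _).2 e.injective
  have : Epi φ := (Rep.epi_iff_surjective _).2 e.surjective
  have := isIso_of_mono_of_epi φ
  exact ⟨asIso φ⟩

end Homs

end KleinFour

/-! ### The dimension formula -/

theorem Rep.finrank_hom_congr {k : Type u} [Field k] {G : Type v} [Group G] (A : Rep.{u} k G)
    {N N' : Rep.{u} k G} (e : N ≅ N') :
    Module.finrank k (A ⟶ N) = Module.finrank k (A ⟶ N') :=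
  (Linear.homCongr k (Iso.refl A) e).finrank_eq

end

theorem mainTheorem4 {k : Type u} [Field k] [CharP k 2] {G : Type v} [Group G] [IsKleinFour G]
    {σ τ : G} (hσ : σ ≠ 1) (hτ : τ ≠ 1) (hστ : σ ≠ τ) :
    Nonempty (RelProjectiveResolution (KleinFour.chi σ τ) (Rep.trivial k G k)) ∧
    ∀ (R : RelProjectiveResolution (KleinFour.chi σ τ) (Rep.trivial k G k))
      (n : ℕ) (_ : 1 ≤ n) (N : Rep.{u} k G) (_ : Nonempty (N ≅ KleinFour.VNeg k n hσ hτ hστ))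
      (i : ℕ),
      Module.Finite k (R.ext i N) ∧
      ((i : ℚ) ≤ (n : ℚ) / 2 → (Module.finrank k (R.ext i N) : ℤ) = (n : ℤ) + 1 - 2 * (i : ℤ)) ∧
      ((n : ℚ) / 2 < (i : ℚ) → (Module.finrank k (R.ext i N) : ℤ) = max (0 : ℤ) (2 * (i : ℤ) - (n : ℤ) - 3)) := by
  let S : RelSyzygies (KleinFour.chi σ τ) (Rep.trivial k G k) :=
    KleinFour.trivialSyzygies hσ hτ hστ
  refine ⟨⟨S.resolution⟩, fun R n hn N ⟨e⟩ i => ?_⟩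
  obtain ⟨e'⟩ := KleinFour.nonempty_VNeg_iso_polyRep (k := k) hσ hτ hστ n
  have : Module.Finite k N := Module.Finite.of_injective
    ((e ≪≫ e').hom.hom.toLinearMap : N →ₗ[k] KleinFour.PolySpace k n)
    ((Rep.mono_iff_injective _).1 inferInstance)
  obtain ⟨r⟩ := R.nonempty_ext_linearEquiv S.resolution i N
  have hK : ∀ j, Module.finrank k (S.K j ⟶ N) = (n + 1 - 2 * j) + 2 * j * (n + 1) := fun j =>
    (Rep.finrank_hom_congr _ (e ≪≫ e')).trans
      (KleinFour.finrank_polyRep_hom hσ hτ hστ (2 * j) n)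
  have hQ : ∀ j, Module.finrank k (S.Q j ⟶ N) = 3 * (n + 1) + 2 * j * (2 * n + 1) := fun j =>
    (Rep.finrank_hom_congr _ (e ≪≫ e')).trans
      (KleinFour.finrank_relFree_polyRep k hσ hτ hστ (2 * j) n)
  obtain ⟨hfin, h0, hsucc⟩ := S.finite_ext_and_finrank N i
  refine ⟨Module.Finite.equiv r.symm, ?_⟩
  rw [r.finrank_eq, div_lt_iff₀ two_pos, le_div_iff₀ two_pos]
  have c1 : (i : ℚ) * 2 ≤ n ↔ i * 2 ≤ n := by norm_cast
  have c2 : (n : ℚ) < i * 2 ↔ n < i * 2 := by norm_cast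
  rw [c1, c2]
  rcases i with _ | j
  · rw [h0 rfl, hK]
    omega
  · have h := hsucc j rfl
    rw [hK, hK, hQ] at h
    generalize Module.finrank k (S.resolution.ext (j + 1) N) = t at h ⊢
    generalize hx : n + 1 - 2 * (j + 1) = x at h
    generalize hy : n + 1 - 2 * j = y at h
    -- The products of j and n cancel. What remains is linear in the truncated differences x and y,
    -- whose vanishing separates the cases.
    have h' : t + n + 1 = 2 * j + x + y := by linear_combination h
    omega
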